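/- **Setting.** Fix $c\in\mathbb R$ and put $\phi(x)=(x-c)^2$. A map of class $\mathcal T$ is a map $g:\bigcup_k I_k\to J$, where $J$ is a compact interval symmetric about $c$ and $\{I_k\}$ is a (finite or infinite) family of pairwise disjoint nondegenerate compact subintervals of $J$, such that the central interval $I_0\ni c$ is symmetric about $c$ and contained in the interior of $J$, and $g|I_k=h_k\circ\phi$ for every $k$, where $h_k$ is a $C^3$ diffeomorphism with negative Schwarzian derivative of a compact interval $A_k$ onto $J$. For $k\neq 0$, $A_k=\phi(I_k)$ (so $g$ maps $I_k$ diffeomorphically onto $J$); for $k=0$, $A_0\supset\phi(I_0)$ has the same right endpoint as $\phi(I_0)$ (so $g|I_0$ is unimodal and $g(\partial I_0)\subset\partial J$). Let $g_1\in\mathcal T$ have a recurrent critical point: the orbit of $c$ is defined for all times and $c\in\omega(c)$. Define inductively $g_{n+1}:\bigcup_k I^{n+1}_k\to I^n$ as the first return map of $g_n:\bigcup_k I_k^n\to I^{n-1}$ to its central interval $I^n=I^n_0$, restricted to those components of its domain that meet $\omega(c)$. If $I^{n+1}_k$ has return time $l$, then $g_{n+1}|I^{n+1}_k=h_{n+1,k}\circ\phi$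 with $h_{n+1,k}=g_n^{\,l-1}\circ h_{n,0}$, taken on the preimage under $h_{n,0}$ of the monotone pull-back of $I^n$ by $g_n^{\,l-1}$ along the orbit of $g_n(I_k^{n+1})$, so that $h_{n+1,k}$ maps onto $I^n$. For an interval $G\subset L$ with complementary components $U,V$ in $L$, let $P(G|L)=\log(1+|G|/|U|)+\log(1+|G|/|V|)$ (which is $\infty$ if $U$ or $V$ is degenerate). For disjoint intervals $U,V$ with gap $G$ not meeting $c$, $U$ being closer to $c$ than $V$ (possibly $c\in U$), let $Q(U,V)=\log(1+|G|/|U|)+\tfrac12\log(1+|G|/|V|)$. The parameters of level $n$ are - $\mu_n=|I^n|/|I^{n-1}|$; - $\lambda_n=\sup_{k\ne0}P(I^n_k|I^{n-1})$ and $\lambda_n^*=\min(\lambda_n,1)$; - $K_n$, the infimum of $Q(I^n_s,I^n_t)$ over all pairs of distinct intervals of level $n$ that lie on the same side of $c$ or one of which is central; - $\rho_n$, the supremum over $k$ of the distortions $\sup_{x,y}\log\bigl(|h_{n,k}'(x)|/|h_{n,k}'(y)|\bigr)$, with $x,y$ in the domain of $h_{n,k}$. **Lemma 3.12.** For every $\bar\mu\in(0,1)$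 there is a constant $C>0$, depending only on $\bar\mu$, with the following property. Let $0<\bar\rho<\bar\mu$ and $\bar K>0$, let $g_1$ be as above, and let $n\ge1$ be a level with $$\rho_n<\bar\rho,\qquad \mu_n<\bar\mu,\qquad K_n>\bar K .$$ Write $\mu=\mu_n$, $\lambda^*=\lambda_n^*$ and $\mu'=\mu_{n+1}$, $\lambda'=\lambda_{n+1}$, $\rho'=\rho_{n+1}$, $K'=K_{n+1}$. Then $$\lambda'\le C\sqrt{\mu},\qquad \mu'\le C\sqrt{\mu},\qquad \rho'\le C\mu,\qquad K'\ge\tfrac12\log\tfrac1\mu-C .$$ If moreover the return is non-central, that is $g_n(c)\notin I^n$, then $$\mu'\le C\sqrt{\mu\,\lambda^*} .$$ -/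

import Mathlib

open scoped ENNReal

noncomputable section

namespace Renorm

/-! ### Poincaré lengths -/

/-- Left endpoint of a bounded interval. -/
def lo (W : Set ℝ) : ℝ := sInf W

/-- Right endpoint of a bounded interval. -/
def hi (W : Set ℝ) : ℝ := sSup W

/-- Length of a bounded interval. -/
def len (W : Set ℝ) : ℝ := hi W - lo W

/-- The number `log (1 + x / y)`, with value `∞` when the denominator vanishes. -/
def logRatio (x y : ℝ) : ℝ≥0∞ :=
  if 0 < y then ENNReal.ofReal (Real.log (1 + x / y)) else ⊤

/-- Poincaré length `P(G | L)` of the interval `G` in the interval `L`. It is `∞` if `G` and `L`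
share an endpoint. -/
def poincareLength (G L : Set ℝ) : ℝ≥0∞ :=
  logRatio (len G) (lo G - lo L) + logRatio (len G) (hi L - hi G)

/-- `IsCloser c U V`: the gap between the intervals `U` and `V` has no interior point equal to `c`,
and `U` is closer to `c` than `V` (`U` may contain `c`). -/
def IsCloser (c : ℝ) (U V : Set ℝ) : Prop :=
  (c ≤ hi U ∧ hi U ≤ lo V) ∨ (hi V ≤ lo U ∧ lo U ≤ c)

/-- Length of the gap between two disjoint intervals. -/
def gapLen (U V : Set ℝ) : ℝ := max (lo V - hi U) (lo U - hi V)

/-- Asymmetric Poincaré length `Q(U, V)` of the gap between `U` and `V`, where `U` is the interval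
closer to the critical point. -/
def asymLength (U V : Set ℝ) : ℝ≥0∞ :=
  logRatio (gapLen U V) (len U) + logRatio (gapLen U V) (len V) / 2

/-! ### Diffeomorphisms with negative Schwarzian derivative -/

/-- Schwarzian derivative. -/
def schwarzian (h : ℝ → ℝ) (z : ℝ) : ℝ :=
  deriv (deriv (deriv h)) z / deriv h z - 3 / 2 * (deriv (deriv h) z / deriv h z) ^ 2

/-- `h` restricts to a `C³` diffeomorphism of the nondegenerate compact interval `A` onto `J`, with
negative Schwarzian derivative. -/
structure IsNegSchwarzDiffeo (h : ℝ → ℝ) (A J : Set ℝ) : Prop where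
  interval : ∃ a b : ℝ, a < b ∧ A = Set.Icc a b
  smooth : ContDiffOn ℝ 3 h A
  deriv_ne : ∀ z ∈ A, derivWithin h A z ≠ 0
  onto : h '' A = J
  neg : ∀ z ∈ interior A, schwarzian h z < 0

/-- Distortion (non-linearity) of `h` on `A`: the supremum of `log (|h' x| / |h' y|)`. -/
def distortion (h : ℝ → ℝ) (A : Set ℝ) : ℝ≥0∞ :=
  ⨆ x ∈ A, ⨆ y ∈ A, ENNReal.ofReal (Real.log (|derivWithin h A x| / |derivWithin h A y|))

/-! ### Maps of class `𝒯` -/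

/-- The data of a map `g : ⋃ I_k → J` together with a decomposition `g | I_k = h_k ∘ φ`,
`φ x = (x - c) ^ 2`. The intervals `I_k` serve as their own indices. Values of `map` outside
`⋃ I_k`, and of `dom`, `diffeo` at sets which are not among the `I_k`, are irrelevant. -/
structure TData where
  /-- the critical point -/
  c : ℝ
  /-- the range `J` -/
  J : Set ℝ
  /-- the family of the intervals `I_k` -/
  pieces : Set (Set ℝ)
  /-- the map `g` -/
  map : ℝ → ℝ
  /-- the domain of definition of `h_k` -/
  dom : Set ℝ → Set ℝ
  /-- the diffeomorphism `h_k` -/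
  diffeo : Set ℝ → ℝ → ℝ

namespace TData

variable (g : TData)

/-- The central interval `I = I_0`, the one containing the critical point. -/
def central : Set ℝ := ⋃₀ {W ∈ g.pieces | g.c ∈ W}

/-- The quadratic map `φ x = (x - c) ^ 2`. -/
def phi (x : ℝ) : ℝ := (x - g.c) ^ 2

/-- Maps of class `𝒯`, with negative Schwarzian derivative and purely quadratic at the critical
point. The interval `J` and the central interval `I ⊂ int J` are symmetric about `c`. On each
interval `I_k` the map is `h_k ∘ φ`, where `h_k` is a diffeomorphism of an interval onto `J` with
negative Schwarzian derivative. For a non-central `I_k` this interval is `φ I_k`, so that `I_k` is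
mapped diffeomorphically onto `J`. For the central one it contains `φ I = [0, r²]` and has the
same right endpoint, so that `g | I` is unimodal and maps `∂I` into `∂J`. -/
structure ClassT : Prop where
  symm : ∃ r R : ℝ, 0 < r ∧ r < R ∧ g.J = Set.Icc (g.c - R) (g.c + R) ∧
    Set.Icc (g.c - r) (g.c + r) ∈ g.pieces
  interval : ∀ W ∈ g.pieces, ∃ a b : ℝ, a < b ∧ W = Set.Icc a b
  subset : ∀ W ∈ g.pieces, W ⊆ g.J
  disj : ∀ U ∈ g.pieces, ∀ V ∈ g.pieces, U ≠ V → Disjoint U V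
  diff : ∀ W ∈ g.pieces, IsNegSchwarzDiffeo (g.diffeo W) (g.dom W) g.J
  decomp : ∀ W ∈ g.pieces, ∀ x ∈ W, g.map x = g.diffeo W (g.phi x)
  dom_noncentral : ∀ W ∈ g.pieces, g.c ∉ W → g.dom W = g.phi '' W
  dom_central : g.phi '' g.central ⊆ g.dom g.central ∧
    hi (g.dom g.central) = hi (g.phi '' g.central)

/-- The limit set `ω(c)` of the critical orbit. -/
def omegaCrit : Set ℝ := {y | MapClusterPt y Filter.atTop (fun n : ℕ => g.map^[n] g.c)}

/-- The critical point is recurrent: its orbit is defined for all times, and `c ∈ ω(c)`. -/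
def Recurrent : Prop := (∀ n : ℕ, g.map^[n] g.c ∈ ⋃₀ g.pieces) ∧ g.c ∈ g.omegaCrit

/-! ### The pre-renormalization: first return map to the central interval -/

/-- The point `x` of `I` returns to `I` for the first time at time `k`. -/
def FirstReturn (x : ℝ) (k : ℕ) : Prop :=
  x ∈ g.central ∧ 0 < k ∧ (∀ j < k, g.map^[j] x ∈ ⋃₀ g.pieces) ∧
    (∀ j, 0 < j → j < k → g.map^[j] x ∉ g.central) ∧ g.map^[k] x ∈ g.central

/-- The first return time of `x`. -/
def returnTime (x : ℝ) : ℕ := sInf {k | g.FirstReturn x k}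

/-- Pull-back of `I` by `g^k` along the orbit of `x`: the points `y` whose `j`-th iterate lies in
the same interval of the family as that of `x`, for `j < k`, and whose `k`-th iterate is in `I`. -/
def pullback (k : ℕ) (x : ℝ) : Set ℝ :=
  {y | (∀ j < k, ∃ W ∈ g.pieces, g.map^[j] x ∈ W ∧ g.map^[j] y ∈ W) ∧ g.map^[k] y ∈ g.central}

/-- The component containing `x` of the domain of the first return map, `k` being the return
time of `x`. -/
def component (k : ℕ) (x : ℝ) : Set ℝ := Set.ordConnectedComponent (g.pullback k x) x

/-- The pre-renormalization `g'` of `g`: the first return map to `I`, restricted to those components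
of its domain which meet `ω(c)`. If `I'_k` is a component with return time `l`, the new
diffeomorphism is `h'_k = g^(l-1) ∘ h_0`, defined on the `h_0`-preimage of the monotone
pull-back of `I` by `g^(l-1)` along the orbit of `g(I'_k)`, so that it maps onto `I`. -/
def prerenorm : TData where
  c := g.c
  J := g.central
  pieces := {W | (∃ x k, g.FirstReturn x k ∧ W = g.component k x) ∧ (W ∩ g.omegaCrit).Nonempty}
  map := fun x => g.map^[g.returnTime x] x
  dom := fun W => {z ∈ g.dom g.central | ∃ x ∈ W, ∃ k, g.FirstReturn x k ∧
    g.diffeo g.central z ∈ g.pullback (k - 1) (g.map x)}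
  diffeo := fun W z => g.map^[sInf (g.returnTime '' W) - 1] (g.diffeo g.central z)

/-- The sequence of pre-renormalized maps; `g.level 0 = g` is the first map of the sequence. -/
def level : ℕ → TData
  | 0 => g
  | n + 1 => (level n).prerenorm

/-! ### Parameters of a level -/

/-- The scaling factor `μ = |I| / |J|`. -/
def mu : ℝ := len g.central / len g.J

/-- `λ`: the supremum of the Poincaré lengths of the non-central intervals in `J`. -/
def lam : ℝ≥0∞ := ⨆ W ∈ g.pieces, ⨆ _ : g.c ∉ W, poincareLength W g.J

/-- `λ* = min (λ, 1)`. -/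
def lamStar : ℝ := (min g.lam 1).toReal

/-- `ρ`: the supremum of the distortions of the diffeomorphisms `h_k`. -/
def rho : ℝ≥0∞ := ⨆ W ∈ g.pieces, distortion (g.diffeo W) (g.dom W)

/-- `K`: the infimum of the asymmetric Poincaré lengths of the gaps between intervals which lie on
the same side of `c`, or one of which is central. -/
def gapK : ℝ≥0∞ := ⨅ U ∈ g.pieces, ⨅ V ∈ g.pieces, ⨅ _ : IsCloser g.c U V, asymLength U V

/-- Non-central return: `g(c)` is not in the central interval. -/
def NonCentralReturn : Prop := g.map g.c ∉ g.central

end TData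

end Renorm

end

/-! Maps with negative Schwarzian derivative do not decrease cross ratios, and neither do their
compositions. A branch of the first return map to `I = [c - r, c + r]` is `(g^k ∘ h₀) ∘ φ`, where
`g^k ∘ h₀` extends to a map onto `J = [c - R, c + R]` expanding cross ratios. Since the cross ratio
of `I` in `J` is `4 r R / (R - r)² = O(μ)`, the preimage of `I` is at most `O(μ)` times as long as
each of the two components of its complement in the preimage of `J`, and the distortion there is
`O(μ)`. Pulling back by `φ` turns `μ` into `√μ` near `c`.

If the return is non-central, the preimages of `I` and `J` under `g^k` near `g(c)` lie in the
interval `I_k` which contains `g(c)`. Its length is `O(λ)` times its distance to the boundary of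
`J`, and pulling back by `h₀` yields the additional factor `λ` under the square root. -/

namespace Renorm
open Set Filter Topology
open scoped ENNReal

/-! ### Maps expanding cross ratios -/

/-- `f` is a map of `[a, b]` with nonvanishing derivative which does not decrease the cross ratios
`|yz| |xw| / (|xy| |zw|)`. Dividing by the cross ratio of the points themselves turns this into an
inequality between difference quotients. -/
structure CrossExpanding (f : ℝ → ℝ) (a b : ℝ) : Prop where
  lt : a < b
  derivWithin_ne_zero : ∀ z ∈ Icc a b, derivWithin f (Icc a b) z ≠ 0
  slope_mul_slope_le : ∀ ⦃x y z w⦄, a ≤ x → x < y → y < z → z < w → w ≤ b →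
    |slope f x y| * |slope f z w| ≤ |slope f y z| * |slope f x w|

namespace CrossExpanding

variable {f h : ℝ → ℝ} {a b a' b' x y z w : ℝ}

theorem hasDerivWithinAt (hf : CrossExpanding f a b) (hz : z ∈ Icc a b) :
    HasDerivWithinAt f (derivWithin f (Icc a b) z) (Icc a b) z :=
  (differentiableWithinAt_of_derivWithin_ne_zero (hf.derivWithin_ne_zero z hz)).hasDerivWithinAt

theorem continuousOn (hf : CrossExpanding f a b) : ContinuousOn f (Icc a b) :=
  fun _ hz => (hf.hasDerivWithinAt hz).continuousWithinAt

theorem strictMonoOn_or_strictAntiOn (hf : CrossExpanding f a b) :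
    StrictMonoOn f (Icc a b) ∨ StrictAntiOn f (Icc a b) := by
  have hd : ∀ z ∈ interior (Icc a b), deriv f z = derivWithin f (Icc a b) z := fun z hz =>
    (derivWithin_of_mem_nhds (mem_interior_iff_mem_nhds.1 hz)).symm
  rcases hasDerivWithinAt_forall_lt_or_forall_gt_of_forall_ne (convex_Icc a b)
    (fun z hz => hf.hasDerivWithinAt hz) hf.derivWithin_ne_zero with hneg | hpos
  · exact .inr <| strictAntiOn_of_deriv_neg (convex_Icc a b) hf.continuousOn fun z hz =>
      (hd z hz).trans_lt (hneg z (interior_subset hz))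
  · exact .inl <| strictMonoOn_of_deriv_pos (convex_Icc a b) hf.continuousOn fun z hz =>
      (hpos z (interior_subset hz)).trans_eq (hd z hz).symm

theorem injOn (hf : CrossExpanding f a b) : InjOn f (Icc a b) :=
  hf.strictMonoOn_or_strictAntiOn.elim StrictMonoOn.injOn StrictAntiOn.injOn

theorem congr (hf : CrossExpanding f a b) (he : EqOn h f (Icc a b)) : CrossExpanding h a b where
  lt := hf.lt
  derivWithin_ne_zero z hz := by
    rw [derivWithin_congr he (he hz)]
    exact hf.derivWithin_ne_zero z hz
  slope_mul_slope_le x y z w hx hxy hyz hzw hw := by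
    simp only [slope_def_field, he (x := x) ⟨hx, by linarith⟩,
      he (x := y) ⟨by linarith, by linarith⟩, he (x := z) ⟨by linarith, by linarith⟩,
      he (x := w) ⟨by linarith, hw⟩]
    simpa only [slope_def_field] using hf.slope_mul_slope_le hx hxy hyz hzw hw

theorem restrict (hf : CrossExpanding f a b) (ha : a ≤ a') (hab' : a' < b') (hb : b' ≤ b) :
    CrossExpanding f a' b' where
  lt := hab'
  derivWithin_ne_zero z hz := by
    have hz' : z ∈ Icc a b := Icc_subset_Icc ha hb hz
    rw [((hf.hasDerivWithinAt hz').mono (Icc_subset_Icc ha hb)).derivWithin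
      (uniqueDiffOn_Icc hab' z hz)]
    exact hf.derivWithin_ne_zero z hz'
  slope_mul_slope_le _ _ _ _ hx hxy hyz hzw hw :=
    hf.slope_mul_slope_le (ha.trans hx) hxy hyz hzw (hw.trans hb)

theorem slope_mul_slope_le_of_gt (hf : CrossExpanding f a b) (hx : x ≤ b) (hxy : y < x)
    (hyz : z < y) (hzw : w < z) (hw : a ≤ w) :
    |slope f x y| * |slope f z w| ≤ |slope f y z| * |slope f x w| := by
  rw [slope_comm f x y, slope_comm f z w, slope_comm f y z, slope_comm f x w, mul_comm]
  exact hf.slope_mul_slope_le hw hzw hyz hxy hx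

theorem comp (hf : CrossExpanding f a' b') (hh : CrossExpanding h a b)
    (hm : MapsTo h (Icc a b) (Icc a' b')) : CrossExpanding (f ∘ h) a b where
  lt := hh.lt
  derivWithin_ne_zero z hz := by
    rw [((hf.hasDerivWithinAt (hm hz)).comp z (hh.hasDerivWithinAt hz) hm).derivWithin
      (uniqueDiffOn_Icc hh.lt z hz)]
    exact mul_ne_zero (hf.derivWithin_ne_zero _ (hm hz)) (hh.derivWithin_ne_zero z hz)
  slope_mul_slope_le x y z w hx hxy hyz hzw hw := by
    have mx : x ∈ Icc a b := ⟨hx, by linarith⟩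
    have my : y ∈ Icc a b := ⟨by linarith, by linarith⟩
    have mz : z ∈ Icc a b := ⟨by linarith, by linarith⟩
    have mw : w ∈ Icc a b := ⟨by linarith, hw⟩
    have chain : ∀ {s t}, s ∈ Icc a b → t ∈ Icc a b → s < t →
        |slope (f ∘ h) s t| = |slope f (h s) (h t)| * |slope h s t| := fun hs ht hst => by
      have hne := sub_ne_zero.2 fun e => hst.ne' (hh.injOn ht hs e)
      simp only [slope_def_field, Function.comp_apply, ← abs_mul]
      rw [div_mul_div_cancel₀ hne]
    have outer : |slope f (h x) (h y)| * |slope f (h z) (h w)| ≤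
        |slope f (h y) (h z)| * |slope f (h x) (h w)| := by
      rcases hh.strictMonoOn_or_strictAntiOn with m | m
      · exact hf.slope_mul_slope_le (hm mx).1 (m mx my hxy) (m my mz hyz) (m mz mw hzw) (hm mw).2
      · exact hf.slope_mul_slope_le_of_gt (hm mx).2 (m mx my hxy) (m my mz hyz) (m mz mw hzw)
          (hm mw).1
    rw [chain mx my hxy, chain mz mw hzw, chain my mz hyz, chain mx mw (by linarith),
      mul_mul_mul_comm, mul_mul_mul_comm |slope f (h y) (h z)|]
    exact mul_le_mul outer (hh.slope_mul_slope_le hx hxy hyz hzw hw) (by positivity) (by positivity)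

theorem neg (hf : CrossExpanding f a b) : CrossExpanding (fun x => -f x) a b where
  lt := hf.lt
  derivWithin_ne_zero z hz := by
    rw [derivWithin.fun_neg]
    exact neg_ne_zero.2 (hf.derivWithin_ne_zero z hz)
  slope_mul_slope_le x y z w hx hxy hyz hzw hw := by
    have abs_slope_neg : ∀ s t, |slope (fun x => -f x) s t| = |slope f s t| := fun s t => by
      rw [slope_def_field, slope_def_field, neg_sub_neg, abs_div, abs_div, abs_sub_comm]
    simpa only [abs_slope_neg] using hf.slope_mul_slope_le hx hxy hyz hzw hw

theorem id (hab : a < b) : CrossExpanding (fun x => x) a b where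
  lt := hab
  derivWithin_ne_zero z hz := by
    rw [(hasDerivAt_id' z).hasDerivWithinAt.derivWithin (uniqueDiffOn_Icc hab z hz)]
    exact one_ne_zero
  slope_mul_slope_le x y z w _ hxy hyz hzw _ := by
    have abs_slope_id : ∀ {s t : ℝ}, s < t → |slope (fun x => x) s t| = 1 := fun hst => by
      rw [slope_def_field, div_self (sub_pos.2 hst).ne', abs_one]
    rw [abs_slope_id hxy, abs_slope_id hyz, abs_slope_id hzw,
      abs_slope_id (hxy.trans (hyz.trans hzw))]

theorem reflect (hf : CrossExpanding f a b) : CrossExpanding (fun x => f (-x)) (-b) (-a) :=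
  hf.comp (id (neg_lt_neg hf.lt)).neg fun _ hx => ⟨by linarith [hx.2], by linarith [hx.1]⟩

theorem sub_sq {c : ℝ} (hc : c ∉ Icc a b) (hab : a < b) :
    CrossExpanding (fun x => (x - c) ^ 2) a b where
  lt := hab
  derivWithin_ne_zero z hz := by
    have hd := (((hasDerivAt_id' z).sub_const c).fun_pow 2).hasDerivWithinAt (s := Icc a b)
    rw [hd.derivWithin (uniqueDiffOn_Icc hab z hz)]
    simpa [sub_eq_zero] using fun e : z = c => hc (e ▸ hz)
  slope_mul_slope_le x y z w hx hxy hyz hzw hw := by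
    have slope_sq : ∀ {s t}, s < t → slope (fun x => (x - c) ^ 2) s t = (s - c) + (t - c) :=
      fun hst => by
        rw [slope_def_field, div_eq_iff (sub_pos.2 hst).ne']
        ring
    rw [slope_sq hxy, slope_sq hyz, slope_sq hzw, slope_sq (hxy.trans (hyz.trans hzw)),
      ← abs_mul, ← abs_mul]
    have hprod : 0 < (z - x) * (w - y) := mul_pos (by linarith) (by linarith)
    rcases lt_or_gt_of_ne (fun e => hc ⟨e ▸ hx, by linarith⟩ : c ≠ x) with hcx | hxc
    · have hpos : 0 < (x - c + (y - c)) * (z - c + (w - c)) :=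
        mul_pos (by linarith) (by linarith)
      rw [abs_of_pos hpos, abs_of_pos (mul_pos (by linarith) (by linarith))]
      linarith
    · have hbc : b < c := by
        by_contra! hcb
        exact hc ⟨hx.trans hxc.le, hcb⟩
      have hpos : 0 < (x - c + (y - c)) * (z - c + (w - c)) :=
        mul_pos_of_neg_of_neg (by linarith) (by linarith)
      rw [abs_of_pos hpos, abs_of_pos (mul_pos_of_neg_of_neg (by linarith) (by linarith))]
      linarith

theorem exists_inter_preimage_Icc_eq (hf : CrossExpanding f a b) {A B α β : ℝ}
    (him : f '' Icc a b = Icc A B) (hα : A ≤ α) (hαβ : α < β) (hβ : β ≤ B) :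
    ∃ p q, a ≤ p ∧ p < q ∧ q ≤ b ∧ Icc a b ∩ f ⁻¹' Icc α β = Icc p q := by
  obtain ⟨s, hs, rfl⟩ : α ∈ f '' Icc a b := him ▸ ⟨hα, hαβ.le.trans hβ⟩
  obtain ⟨t, ht, rfl⟩ : β ∈ f '' Icc a b := him ▸ ⟨hα.trans hαβ.le, hβ⟩
  rcases hf.strictMonoOn_or_strictAntiOn with m | m
  · refine ⟨s, t, hs.1, (m.lt_iff_lt hs ht).1 hαβ, ht.2, Set.ext fun z => ⟨fun hz => ?_, ?_⟩⟩
    · exact ⟨(m.le_iff_le hs hz.1).1 hz.2.1, (m.le_iff_le hz.1 ht).1 hz.2.2⟩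
    · intro hz
      have hz' : z ∈ Icc a b := Icc_subset_Icc hs.1 ht.2 hz
      exact ⟨hz', (m.le_iff_le hs hz').2 hz.1, (m.le_iff_le hz' ht).2 hz.2⟩
  · refine ⟨t, s, ht.1, (m.lt_iff_gt hs ht).1 hαβ, hs.2, Set.ext fun z => ⟨fun hz => ?_, ?_⟩⟩
    · exact ⟨(m.le_iff_ge hz.1 ht).1 hz.2.2, (m.le_iff_ge hs hz.1).1 hz.2.1⟩
    · intro hz
      have hz' : z ∈ Icc a b := Icc_subset_Icc ht.1 hs.2 hz
      exact ⟨hz', (m.le_iff_ge hs hz').2 hz.2, (m.le_iff_ge hz' ht).2 hz.1⟩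

theorem image_endpoints (hf : CrossExpanding f a b) {A B : ℝ} (him : f '' Icc a b = Icc A B) :
    (f a = A ∧ f b = B) ∨ (f a = B ∧ f b = A) := by
  have ha : a ∈ Icc a b := left_mem_Icc.2 hf.lt.le
  have hb : b ∈ Icc a b := right_mem_Icc.2 hf.lt.le
  have hmem : ∀ z ∈ Icc a b, f z ∈ Icc A B := fun z hz => him ▸ mem_image_of_mem f hz
  have hAB : A ≤ B := (hmem a ha).1.trans (hmem a ha).2
  obtain ⟨s, hs, hsA⟩ : A ∈ f '' Icc a b := him ▸ left_mem_Icc.2 hAB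
  obtain ⟨t, ht, htB⟩ : B ∈ f '' Icc a b := him ▸ right_mem_Icc.2 hAB
  rcases hf.strictMonoOn_or_strictAntiOn with m | m
  · exact .inl ⟨le_antisymm (hsA ▸ m.monotoneOn ha hs hs.1) (hmem a ha).1,
      le_antisymm (hmem b hb).2 (htB ▸ m.monotoneOn ht hb ht.2)⟩
  · exact .inr ⟨le_antisymm (hmem a ha).2 (htB ▸ m.antitoneOn ha ht ht.1),
      le_antisymm (hsA ▸ m.antitoneOn hs hb hs.2) (hmem b hb).1⟩

theorem exists_inter_preimage_Icc_eq_of_lt (hf : CrossExpanding f a b) {A B α β : ℝ}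
    (him : f '' Icc a b = Icc A B) (hα : A < α) (hαβ : α < β) (hβ : β < B) :
    ∃ p q, a < p ∧ p < q ∧ q < b ∧ Icc a b ∩ f ⁻¹' Icc α β = Icc p q := by
  obtain ⟨p, q, hap, hpq, hqb, heq⟩ := hf.exists_inter_preimage_Icc_eq him hα.le hαβ hβ.le
  have hp : f p ∈ Icc α β := (heq.superset (left_mem_Icc.2 hpq.le)).2
  have hq : f q ∈ Icc α β := (heq.superset (right_mem_Icc.2 hpq.le)).2
  refine ⟨p, q, lt_of_le_of_ne hap ?_, hpq, lt_of_le_of_ne hqb ?_, heq⟩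
  · rintro rfl
    rcases hf.image_endpoints him with h | h <;> linarith [h.1, hp.1, hp.2]
  · rintro rfl
    rcases hf.image_endpoints him with h | h <;> linarith [h.2, hq.1, hq.2]

theorem tendsto_abs_slope (hf : CrossExpanding f a b) (hx : x ∈ Ico a b) :
    Tendsto (fun t => |slope f x t|) (𝓝[>] x) (𝓝 |derivWithin f (Icc a b) x|) := by
  have hd : HasDerivWithinAt f (derivWithin f (Icc a b) x) (Ioi x) x :=
    (hf.hasDerivWithinAt (Ico_subset_Icc_self hx)).mono_of_mem_nhdsWithin <|
      mem_of_superset (Ioo_mem_nhdsGT hx.2) fun _ ht => ⟨hx.1.trans ht.1.le, ht.2.le⟩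
  exact ((hasDerivWithinAt_iff_tendsto_slope' self_notMem_Ioi).1 hd).abs

theorem tendsto_abs_slope_left (hf : CrossExpanding f a b) (hx : x ∈ Ico a b) (hxy : x ≠ y) :
    Tendsto (fun t => |slope f t y|) (𝓝[>] x) (𝓝 |slope f x y|) := by
  have hfx : Tendsto f (𝓝[>] x) (𝓝 (f x)) :=
    (hf.continuousOn x (Ico_subset_Icc_self hx)).mono_of_mem_nhdsWithin <|
      mem_of_superset (Ioo_mem_nhdsGT hx.2) fun _ ht => ⟨hx.1.trans ht.1.le, ht.2.le⟩
  have hid : Tendsto (fun t : ℝ => t) (𝓝[>] x) (𝓝 x) := tendsto_id.mono_left nhdsWithin_le_nhds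
  simp only [slope_def_field]
  exact ((hfx.const_sub _).div (hid.const_sub _) (sub_ne_zero.2 hxy.symm)).abs

theorem slope_mul_slope_le_derivWithin_mul (hf : CrossExpanding f a b) (hx : a ≤ x) (hxy : x < y)
    (hyw : y < w) (hw : w ≤ b) :
    |slope f x y| * |slope f y w| ≤ |derivWithin f (Icc a b) y| * |slope f x w| := by
  have hy : y ∈ Ico a b := ⟨hx.trans hxy.le, hyw.trans_le hw⟩
  refine le_of_tendsto_of_tendsto ((hf.tendsto_abs_slope_left hy hyw.ne).const_mul _)
    ((hf.tendsto_abs_slope hy).mul_const _) ?_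
  filter_upwards [Ioo_mem_nhdsGT hyw] with t ht
  exact hf.slope_mul_slope_le hx hxy ht.1 ht.2 hw

theorem derivWithin_mul_slope_le (hf : CrossExpanding f a b) (hx : a ≤ x) (hxy : x < y)
    (hyw : y < w) (hw : w ≤ b) :
    |derivWithin f (Icc a b) x| * |slope f y w| ≤ |slope f x y| * |slope f x w| := by
  have hx' : x ∈ Ico a b := ⟨hx, (hxy.trans hyw).trans_le hw⟩
  refine le_of_tendsto_of_tendsto ((hf.tendsto_abs_slope hx').mul_const _)
    ((hf.tendsto_abs_slope_left hx' hxy.ne).mul_const _) ?_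
  filter_upwards [Ioo_mem_nhdsGT hxy] with t ht
  exact hf.slope_mul_slope_le hx ht.1 ht.2 hyw hw

theorem koebe_right (hf : CrossExpanding f a b) (hx : a ≤ x) (hxy : x < y) (hy : y < b) :
    |derivWithin f (Icc a b) x| * (f b - f y) ^ 2 ≤
      |derivWithin f (Icc a b) y| * (f b - f x) ^ 2 := by
  have hslope : |derivWithin f (Icc a b) x| * |slope f y b| ^ 2 ≤
      |derivWithin f (Icc a b) y| * |slope f x b| ^ 2 := calc
    _ = |derivWithin f (Icc a b) x| * |slope f y b| * |slope f y b| := by ring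
    _ ≤ |slope f x y| * |slope f x b| * |slope f y b| :=
      mul_le_mul_of_nonneg_right (hf.derivWithin_mul_slope_le hx hxy hy le_rfl) (abs_nonneg _)
    _ = |slope f x y| * |slope f y b| * |slope f x b| := by ring
    _ ≤ |derivWithin f (Icc a b) y| * |slope f x b| * |slope f x b| := mul_le_mul_of_nonneg_right
      (hf.slope_mul_slope_le_derivWithin_mul hx hxy hy le_rfl) (abs_nonneg _)
    _ = _ := by ring
  have sub_sq_eq : ∀ s, (f b - f s) ^ 2 = |slope f s b| ^ 2 * (b - s) ^ 2 := fun s => by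
    rw [sq_abs, ← mul_pow, mul_comm, ← smul_eq_mul, sub_smul_slope, vsub_eq_sub]
  rw [sub_sq_eq, sub_sq_eq, ← mul_assoc, ← mul_assoc]
  exact mul_le_mul hslope (pow_le_pow_left₀ (by linarith) (by linarith) 2) (by positivity)
    (by positivity)

theorem koebe_left (hf : CrossExpanding f a b) (hx : a < x) (hxy : x < y) (hy : y ≤ b) :
    |derivWithin f (Icc a b) y| * (f a - f x) ^ 2 ≤
      |derivWithin f (Icc a b) x| * (f a - f y) ^ 2 := by
  have abs_derivWithin_reflect : ∀ s, |derivWithin (fun x => f (-x)) (Icc (-b) (-a)) (-s)| =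
      |derivWithin f (Icc a b) s| := fun s => by
    simp [derivWithin_comp_neg]
  have := hf.reflect.koebe_right (neg_le_neg hy) (neg_lt_neg hxy) (neg_lt_neg hx)
  simpa only [abs_derivWithin_reflect, neg_neg] using this

end CrossExpanding

/-! ### Negative Schwarzian derivative -/

theorem hasDerivAt_inv_sqrt {u : ℝ → ℝ} {u' t : ℝ} (hu : HasDerivAt u u' t) (ht : 0 < u t) :
    HasDerivAt (fun s => (√(u s))⁻¹) (-(u' / (2 * u t)) * (√(u t))⁻¹) t := by
  have hs := Real.sqrt_pos.2 ht
  refine ((hu.sqrt ht.ne').fun_inv hs.ne').congr_deriv ?_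
  rw [Real.sq_sqrt ht.le]
  field_simp

theorem hasDerivAt_half_deriv_log_deriv {f : ℝ → ℝ} {t : ℝ}
    (h₂ : HasDerivAt (deriv f) (deriv (deriv f) t) t)
    (h₃ : HasDerivAt (deriv (deriv f)) (deriv (deriv (deriv f)) t) t) (ht : deriv f t ≠ 0) :
    HasDerivAt (fun s => deriv (deriv f) s / (2 * deriv f s))
      (schwarzian f t / 2 + (deriv (deriv f) t / (2 * deriv f t)) ^ 2) t := by
  refine (h₃.fun_div (h₂.const_mul 2) (mul_ne_zero two_ne_zero ht)).congr_deriv ?_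
  rw [schwarzian]
  field_simp
  ring

theorem hasDerivAt_iterated_deriv {f : ℝ → ℝ} {a b : ℝ} (hf : ContDiffOn ℝ 3 f (Ioo a b)) {t : ℝ}
    (ht : t ∈ Ioo a b) : HasDerivAt f (deriv f t) t ∧
      HasDerivAt (deriv f) (deriv (deriv f) t) t ∧
      HasDerivAt (deriv (deriv f)) (deriv (deriv (deriv f)) t) t := by
  have hasDerivAt_of_contDiffOn : ∀ {n : WithTop ℕ∞} {u : ℝ → ℝ}, n ≠ 0 →
      ContDiffOn ℝ n u (Ioo a b) → HasDerivAt u (deriv u t) t := fun hn hu =>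
    ((hu.differentiableOn hn).differentiableAt (isOpen_Ioo.mem_nhds ht)).hasDerivAt
  have hf₁ : ContDiffOn ℝ 2 (deriv f) (Ioo a b) := hf.deriv_of_isOpen isOpen_Ioo (by norm_num)
  have hf₂ : ContDiffOn ℝ 1 (deriv (deriv f)) (Ioo a b) :=
    hf₁.deriv_of_isOpen isOpen_Ioo (by norm_num)
  exact ⟨hasDerivAt_of_contDiffOn (by norm_num) hf, hasDerivAt_of_contDiffOn (by norm_num) hf₁,
    hasDerivAt_of_contDiffOn (by norm_num) hf₂⟩

section Schwarzian

variable {f : ℝ → ℝ} {a b : ℝ}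

theorem strictMonoOn_Icc_of_deriv_pos (hc : ContinuousOn f (Icc a b))
    (hpos : ∀ t ∈ Ioo a b, 0 < deriv f t) : StrictMonoOn f (Icc a b) :=
  strictMonoOn_of_deriv_pos (convex_Icc a b) hc fun t ht => hpos t (by rwa [interior_Icc] at ht)

/-- The function `(f - f x) / √f'` has second derivative `-(f - f x) / √f' * S f / 2`. -/
theorem convexOn_sub_mul_inv_sqrt_deriv (hf : ContDiffOn ℝ 3 f (Ioo a b))
    (hpos : ∀ t ∈ Ioo a b, 0 < deriv f t) (hneg : ∀ t ∈ Ioo a b, schwarzian f t ≤ 0) {x y : ℝ}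
    (hx : a < x) (hy : y < b) :
    ConvexOn ℝ (Icc x y) fun t => (f t - f x) * (√(deriv f t))⁻¹ := by
  set q : ℝ → ℝ := fun t => deriv (deriv f) t / (2 * deriv f t) with hq
  set v : ℝ → ℝ := fun t => (√(deriv f t))⁻¹
  have mem : ∀ {t}, t ∈ Icc x y → t ∈ Ioo a b := fun ht => ⟨hx.trans_le ht.1, ht.2.trans_lt hy⟩
  have hv' : ∀ t ∈ Icc x y, HasDerivAt v (-q t * v t) t := fun t ht =>
    hasDerivAt_inv_sqrt (hasDerivAt_iterated_deriv hf (mem ht)).2.1 (hpos t (mem ht))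
  have hk₁ : ∀ t ∈ Icc x y, HasDerivAt (fun t => (f t - f x) * v t)
      ((deriv f t - (f t - f x) * q t) * v t) t := fun t ht =>
    (((hasDerivAt_iterated_deriv hf (mem ht)).1.sub_const _).fun_mul (hv' t ht)).congr_deriv
      (by ring)
  have hk₂ : ∀ t ∈ Icc x y, HasDerivAt (fun t => (deriv f t - (f t - f x) * q t) * v t)
      ((f t - f x) * v t * (-(schwarzian f t / 2))) t := fun t ht => by
    obtain ⟨h₁, h₂, h₃⟩ := hasDerivAt_iterated_deriv hf (mem ht)
    have hne := (hpos t (mem ht)).ne'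
    have hfq : deriv (deriv f) t = 2 * deriv f t * q t := by simp only [hq]; field_simp
    refine ((h₂.fun_sub ((h₁.sub_const _).fun_mul
      (hasDerivAt_half_deriv_log_deriv h₂ h₃ hne))).fun_mul (hv' t ht)).congr_deriv ?_
    rw [show deriv (deriv f) t / (2 * deriv f t) = q t from rfl, hfq]
    ring
  refine convexOn_of_hasDerivWithinAt2_nonneg (convex_Icc x y)
    (fun t ht => (hk₁ t ht).continuousAt.continuousWithinAt)
    (fun t ht => (hk₁ t (interior_subset ht)).hasDerivWithinAt)
    (fun t ht => (hk₂ t (interior_subset ht)).hasDerivWithinAt) fun t ht => ?_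
  have ht' := interior_subset ht
  have hmono : StrictMonoOn f (Icc x y) := strictMonoOn_Icc_of_deriv_pos
    (hf.continuousOn.mono fun _ => mem) fun t ht => hpos t (mem (Ioo_subset_Icc_self ht))
  have hft : f x ≤ f t := hmono.monotoneOn (left_mem_Icc.2 (ht'.1.trans ht'.2)) ht' ht'.1
  exact mul_nonneg (mul_nonneg (sub_nonneg.2 hft) (inv_nonneg.2 (Real.sqrt_nonneg _)))
    (by linarith [hneg t (mem ht')])

theorem deriv_mul_deriv_le_slope_sq (hf : ContDiffOn ℝ 3 f (Ioo a b))
    (hpos : ∀ t ∈ Ioo a b, 0 < deriv f t) (hneg : ∀ t ∈ Ioo a b, schwarzian f t ≤ 0) {x y : ℝ}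
    (hx : a < x) (hxy : x < y) (hy : y < b) : deriv f x * deriv f y ≤ slope f x y ^ 2 := by
  have hxp := hpos x ⟨hx, hxy.trans hy⟩
  have hyp := hpos y ⟨hx.trans hxy, hy⟩
  obtain ⟨h₁, h₂, -⟩ := hasDerivAt_iterated_deriv hf (⟨hx, hxy.trans hy⟩ : x ∈ Ioo a b)
  have tangent : √(deriv f x) ≤ slope f x y * (√(deriv f y))⁻¹ := by
    have hd : HasDerivAt (fun t => (f t - f x) * (√(deriv f t))⁻¹) (√(deriv f x)) x := by
      refine ((h₁.sub_const _).fun_mul (hasDerivAt_inv_sqrt h₂ hxp)).congr_deriv ?_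
      rw [sub_self, zero_mul, add_zero, ← div_eq_mul_inv, Real.div_sqrt]
    have := (convexOn_sub_mul_inv_sqrt_deriv hf hpos hneg hx hy).le_slope_of_hasDerivAt
      (left_mem_Icc.2 hxy.le) (right_mem_Icc.2 hxy.le) hxy hd
    rwa [slope_def_field, sub_self, zero_mul, sub_zero, mul_div_right_comm, ← slope_def_field]
      at this
  rw [← div_eq_mul_inv, le_div_iff₀ (Real.sqrt_pos.2 hyp)] at tangent
  calc deriv f x * deriv f y = (√(deriv f x) * √(deriv f y)) ^ 2 := by
        rw [mul_pow, Real.sq_sqrt hxp.le, Real.sq_sqrt hyp.le]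
    _ ≤ slope f x y ^ 2 := pow_le_pow_left₀ (by positivity) tangent 2

/-- The `t`-derivative is `(f' s f' t - (slope f s t)²) / (f t - f s)²`. -/
theorem antitoneOn_inv_sub_deriv_div (hc : ContinuousOn f (Icc a b))
    (hf : ContDiffOn ℝ 3 f (Ioo a b)) (hpos : ∀ t ∈ Ioo a b, 0 < deriv f t)
    (hneg : ∀ t ∈ Ioo a b, schwarzian f t ≤ 0) {s z w : ℝ} (hs : a < s) (hsz : s < z) (hw : w ≤ b) :
    AntitoneOn (fun t => 1 / (t - s) - deriv f s / (f t - f s)) (Icc z w) := by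
  have mono := strictMonoOn_Icc_of_deriv_pos hc hpos
  have ht_pos : ∀ t ∈ Icc z w, 0 < t - s := fun t ht => sub_pos.2 (hsz.trans_le ht.1)
  have hft_pos : ∀ t ∈ Icc z w, 0 < f t - f s := fun t ht => by
    have hst := hsz.trans_le ht.1
    exact sub_pos.2 (mono ⟨hs.le, hst.le.trans (ht.2.trans hw)⟩
      ⟨hs.le.trans hst.le, ht.2.trans hw⟩ hst)
  have hderiv : ∀ t ∈ Ioo z w, HasDerivAt (fun t => 1 / (t - s) - deriv f s / (f t - f s))
      (-1 / (t - s) ^ 2 + deriv f s * deriv f t / (f t - f s) ^ 2) t := fun t ht => by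
    have hft := (hasDerivAt_iterated_deriv hf
      (⟨hs.trans (hsz.trans ht.1), ht.2.trans_le hw⟩ : t ∈ Ioo a b)).1
    have ht' := Ioo_subset_Icc_self ht
    refine (((hasDerivAt_const t (1 : ℝ)).fun_div ((hasDerivAt_id' t).sub_const s)
      (ht_pos t ht').ne').fun_sub ((hasDerivAt_const t (deriv f s)).fun_div (hft.sub_const (f s))
      (hft_pos t ht').ne')).congr_deriv ?_
    ring
  have hcf : ContinuousOn f (Icc z w) := hc.mono (Icc_subset_Icc (hs.trans hsz).le hw)
  refine antitoneOn_of_hasDerivWithinAt_nonpos (convex_Icc z w)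
    ((continuousOn_const.div (continuousOn_id.sub continuousOn_const) fun t ht =>
      (ht_pos t ht).ne').sub (continuousOn_const.div (hcf.sub continuousOn_const) fun t ht =>
      (hft_pos t ht).ne'))
    (fun t ht => (hderiv t (interior_Icc (a := z) ▸ ht)).hasDerivWithinAt) fun t ht => ?_
  rw [interior_Icc] at ht
  have hslope := deriv_mul_deriv_le_slope_sq hf hpos hneg hs (hsz.trans ht.1) (ht.2.trans_le hw)
  have ht' := Ioo_subset_Icc_self ht
  rw [slope_def_field, div_pow, le_div_iff₀ (pow_pos (ht_pos t ht') 2)] at hslope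
  have : deriv f s * deriv f t / (f t - f s) ^ 2 ≤ 1 / (t - s) ^ 2 := by
    rw [div_le_div_iff₀ (pow_pos (hft_pos t ht') 2) (pow_pos (ht_pos t ht') 2), one_mul]
    exact hslope
  rw [neg_div]
  linarith

/-- The `s`-derivative of `log (slope f s t)` is decreasing in `t`. -/
theorem antitoneOn_log_slope_sub_log_slope (hc : ContinuousOn f (Icc a b))
    (hf : ContDiffOn ℝ 3 f (Ioo a b)) (hpos : ∀ t ∈ Ioo a b, 0 < deriv f t)
    (hneg : ∀ t ∈ Ioo a b, schwarzian f t ≤ 0) {x y z w : ℝ} (hx : a ≤ x) (hyz : y < z)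
    (hzw : z ≤ w) (hw : w ≤ b) :
    AntitoneOn (fun s => Real.log (slope f s w) - Real.log (slope f s z)) (Icc x y) := by
  have mono := strictMonoOn_Icc_of_deriv_pos hc hpos
  have sub_pos_of : ∀ s ∈ Icc x y, ∀ t ∈ Icc z w, 0 < t - s ∧ 0 < f t - f s := fun s hs t ht => by
    have hst : s < t := hs.2.trans_lt (hyz.trans_le ht.1)
    exact ⟨sub_pos.2 hst, sub_pos.2 (mono ⟨hx.trans hs.1, hst.le.trans (ht.2.trans hw)⟩
      ⟨(hx.trans hs.1).trans hst.le, ht.2.trans hw⟩ hst)⟩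
  have hcf : ContinuousOn f (Icc x y) :=
    hc.mono (Icc_subset_Icc hx (hyz.le.trans (hzw.trans hw)))
  have cont : ∀ t ∈ Icc z w, ContinuousOn (fun s => Real.log (slope f s t)) (Icc x y) :=
    fun t ht => by
      simp only [slope_def_field]
      exact ((continuousOn_const.sub hcf).div (continuousOn_const.sub continuousOn_id) fun s hs =>
        (sub_pos_of s hs t ht).1.ne').log fun s hs =>
        (div_pos (sub_pos_of s hs t ht).2 (sub_pos_of s hs t ht).1).ne'
  have hderiv : ∀ t ∈ Icc z w, ∀ s ∈ Ioo x y, HasDerivAt (fun s => Real.log (slope f s t))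
      (1 / (t - s) - deriv f s / (f t - f s)) s := fun t ht s hs => by
    obtain ⟨hts, hfts⟩ := sub_pos_of s (Ioo_subset_Icc_self hs) t ht
    have hfs := (hasDerivAt_iterated_deriv hf (⟨hx.trans_lt hs.1,
      hs.2.trans (hyz.trans_le (hzw.trans hw))⟩ : s ∈ Ioo a b)).1
    simp only [slope_def_field]
    refine (((hfs.const_sub (f t)).fun_div ((hasDerivAt_id' s).const_sub t) hts.ne').log
      (div_pos hfts hts).ne').congr_deriv ?_
    field_simp
    ring
  have hz : z ∈ Icc z w := left_mem_Icc.2 hzw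
  have hw' : w ∈ Icc z w := right_mem_Icc.2 hzw
  refine antitoneOn_of_hasDerivWithinAt_nonpos (convex_Icc x y) ((cont w hw').sub (cont z hz))
    (fun s hs => ((hderiv w hw' s (interior_Icc (a := x) ▸ hs)).fun_sub
      (hderiv z hz s (interior_Icc (a := x) ▸ hs))).hasDerivWithinAt) fun s hs => ?_
  rw [interior_Icc] at hs
  exact sub_nonpos.2 (antitoneOn_inv_sub_deriv_div hc hf hpos hneg (hx.trans_lt hs.1)
    (hs.2.trans hyz) hw hz hw' hzw)

theorem slope_mul_slope_le_of_schwarzian_nonpos (hc : ContinuousOn f (Icc a b))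
    (hf : ContDiffOn ℝ 3 f (Ioo a b)) (hpos : ∀ t ∈ Ioo a b, 0 < deriv f t)
    (hneg : ∀ t ∈ Ioo a b, schwarzian f t ≤ 0) {x y z w : ℝ} (hx : a ≤ x) (hxy : x < y)
    (hyz : y < z) (hzw : z < w) (hw : w ≤ b) :
    slope f x y * slope f z w ≤ slope f y z * slope f x w := by
  have mono := strictMonoOn_Icc_of_deriv_pos hc hpos
  have slope_pos : ∀ {s t}, x ≤ s → s < t → t ≤ w → 0 < slope f s t := fun hs hst ht => by
    rw [slope_def_field]
    exact div_pos (sub_pos.2 (mono ⟨hx.trans hs, by linarith⟩ ⟨by linarith, ht.trans hw⟩ hst))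
      (sub_pos.2 hst)
  have hlog := antitoneOn_log_slope_sub_log_slope hc hf hpos hneg hx hyz hzw.le hw
    (left_mem_Icc.2 hxy.le) (right_mem_Icc.2 hxy.le) hxy.le
  have rectangle : slope f y w * slope f x z ≤ slope f x w * slope f y z := by
    have xz := slope_pos le_rfl (hxy.trans hyz) hzw.le
    have xw := slope_pos le_rfl (hxy.trans (hyz.trans hzw)) le_rfl
    have yz := slope_pos hxy.le hyz hzw.le
    have yw := slope_pos hxy.le (hyz.trans hzw) le_rfl
    rw [← Real.log_le_log_iff (by positivity) (by positivity), Real.log_mul yw.ne' xz.ne',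
      Real.log_mul xw.ne' yz.ne']
    linarith
  -- Ptolemy's identity for the points and for their images
  have sub_eq : ∀ s t, f t - f s = slope f s t * (t - s) := fun s t => by
    rw [mul_comm, ← smul_eq_mul, sub_smul_slope, vsub_eq_sub]
  have ptolemy : slope f x z * (z - x) * (slope f y w * (w - y)) =
      slope f x y * (y - x) * (slope f z w * (w - z)) +
      slope f y z * (z - y) * (slope f x w * (w - x)) := by
    simp only [← sub_eq]
    ring
  have hxz : 0 < (z - x) * (w - y) := mul_pos (by linarith) (by linarith)
  have hle := mul_le_mul_of_nonneg_right rectangle hxz.le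
  refine le_of_mul_le_mul_right ?_ (mul_pos (sub_pos.2 hxy) (sub_pos.2 hzw))
  linarith

end Schwarzian

theorem crossExpanding_of_schwarzian_nonpos {h : ℝ → ℝ} {a b : ℝ} (hab : a < b)
    (hsmooth : ContDiffOn ℝ 3 h (Icc a b)) (hpos : ∀ z ∈ Icc a b, 0 < derivWithin h (Icc a b) z)
    (hneg : ∀ z ∈ Ioo a b, schwarzian h z ≤ 0) : CrossExpanding h a b where
  lt := hab
  derivWithin_ne_zero z hz := (hpos z hz).ne'
  slope_mul_slope_le x y z w hx hxy hyz hzw hw := by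
    have hderiv : ∀ t ∈ Ioo a b, 0 < deriv h t := fun t ht => by
      rw [← derivWithin_of_mem_nhds (Icc_mem_nhds ht.1 ht.2)]
      exact hpos t (Ioo_subset_Icc_self ht)
    have slope_nonneg : ∀ {s t}, a ≤ s → s < t → t ≤ b → 0 ≤ slope h s t := fun hs hst ht => by
      rw [slope_def_field]
      exact div_nonneg (sub_nonneg.2 ((strictMonoOn_Icc_of_deriv_pos hsmooth.continuousOn
        hderiv).monotoneOn ⟨hs, by linarith⟩ ⟨by linarith, ht⟩ hst.le)) (sub_pos.2 hst).le
    rw [abs_of_nonneg (slope_nonneg hx hxy (by linarith)),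
      abs_of_nonneg (slope_nonneg (by linarith) hzw hw),
      abs_of_nonneg (slope_nonneg (by linarith) hyz (by linarith)),
      abs_of_nonneg (slope_nonneg hx (by linarith) hw)]
    exact slope_mul_slope_le_of_schwarzian_nonpos hsmooth.continuousOn
      (hsmooth.mono Ioo_subset_Icc_self) hderiv hneg hx hxy hyz hzw hw

theorem schwarzian_neg_fun (h : ℝ → ℝ) (z : ℝ) :
    schwarzian (fun x => -h x) z = schwarzian h z := by
  have deriv_neg : ∀ u : ℝ → ℝ, deriv (fun x => -u x) = fun x => -deriv u x := fun u =>
    funext fun _ => deriv.fun_neg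
  simp only [schwarzian, deriv_neg, neg_div_neg_eq]

theorem IsNegSchwarzDiffeo.crossExpanding {h : ℝ → ℝ} {A J : Set ℝ}
    (hh : IsNegSchwarzDiffeo h A J) :
    ∃ a b, A = Icc a b ∧ CrossExpanding h a b ∧ h '' Icc a b = J := by
  obtain ⟨⟨a, b, hab, rfl⟩, smooth, ne, onto, neg⟩ := hh
  refine ⟨a, b, rfl, ?_, onto⟩
  rw [interior_Icc] at neg
  rcases hasDerivWithinAt_forall_lt_or_forall_gt_of_forall_ne (convex_Icc a b)
    (fun x hx => (differentiableWithinAt_of_derivWithin_ne_zero (ne x hx)).hasDerivWithinAt) ne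
    with hs | hs
  · have hn : CrossExpanding (fun x => -h x) a b := by
      refine crossExpanding_of_schwarzian_nonpos hab smooth.neg (fun z hz => ?_) fun z hz => ?_
      · rw [derivWithin.fun_neg]
        exact neg_pos.2 (hs z hz)
      · exact (schwarzian_neg_fun h z).trans_le (neg z hz).le
    simpa only [neg_neg] using hn.neg
  · exact crossExpanding_of_schwarzian_nonpos hab smooth hs fun z hz => (neg z hz).le

namespace TData

/-! ### Maps with cross ratio expanding branches -/

/-- The class of maps to which the estimates apply: the central interval is `[c - r, c + r]`, the
range `[c - R, c + R]`, the domain of the central diffeomorphism `[a, r²]`, and all branches expand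
cross ratios. -/
structure IsExpanding (g : TData) (r R a : ℝ) : Prop where
  r_pos : 0 < r
  r_lt : r < R
  J_eq : g.J = Icc (g.c - R) (g.c + R)
  central_eq : g.central = Icc (g.c - r) (g.c + r)
  central_mem : g.central ∈ g.pieces
  a_nonpos : a ≤ 0
  dom_eq : g.dom g.central = Icc a (r ^ 2)
  expanding_central : CrossExpanding (g.diffeo g.central) a (r ^ 2)
  image_central : g.diffeo g.central '' Icc a (r ^ 2) = g.J
  map_central : ∀ x ∈ g.central, g.map x = g.diffeo g.central (g.phi x)
  subset : ∀ W ∈ g.pieces, W ⊆ g.J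
  disj : ∀ U ∈ g.pieces, ∀ V ∈ g.pieces, U ≠ V → Disjoint U V
  branch : ∀ W ∈ g.pieces, W ≠ g.central → ∃ α β, W = Icc α β ∧ CrossExpanding g.map α β ∧
    g.map '' Icc α β = g.J

/-- The monotone pull-back of `J` by `g^k` along the orbit of `y`: the points of `J` whose first `k`
iterates lie in the same intervals of the family as those of `y`. -/
def cylinder (g : TData) (k : ℕ) (y : ℝ) : Set ℝ :=
  {u ∈ g.J | ∀ j < k, ∃ W ∈ g.pieces, g.map^[j] y ∈ W ∧ g.map^[j] u ∈ W}

theorem phi_mem_Icc_iff (g : TData) {p q u : ℝ} (hp : 0 < p) (hq : 0 ≤ q) :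
    g.phi u ∈ Icc p q ↔ u ∈ Icc (g.c + √p) (g.c + √q) ∪ Icc (g.c - √q) (g.c - √p) := by
  have hsp := Real.sqrt_pos.2 hp
  have := Real.sqrt_nonneg q
  rw [mem_Icc, phi, ← Real.sqrt_le_sqrt_iff hq, ← Real.sqrt_le_sqrt_iff (sq_nonneg (u - g.c)),
    Real.sqrt_sq_eq_abs, abs_le, le_abs]
  constructor
  · rintro ⟨h | h, h1, h2⟩
    · exact .inl ⟨by linarith, by linarith⟩
    · exact .inr ⟨by linarith, by linarith⟩
  · rintro (⟨h1, h2⟩ | ⟨h1, h2⟩)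
    · exact ⟨.inl (by linarith), by linarith, by linarith⟩
    · exact ⟨.inr (by linarith), by linarith, by linarith⟩

theorem phi_le_iff (g : TData) {q u : ℝ} (hq : 0 ≤ q) :
    g.phi u ≤ q ↔ u ∈ Icc (g.c - √q) (g.c + √q) := by
  rw [phi, ← Real.sqrt_le_sqrt_iff hq, Real.sqrt_sq_eq_abs, abs_le, mem_Icc]
  constructor <;> rintro ⟨h1, h2⟩ <;> constructor <;> linarith

theorem phi_image_Icc_right (g : TData) {p q : ℝ} (hp : 0 ≤ p) (hpq : p ≤ q) :
    g.phi '' Icc (g.c + √p) (g.c + √q) = Icc p q := by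
  ext z
  constructor
  · rintro ⟨x, ⟨hpx, hxq⟩, rfl⟩
    have hx : 0 ≤ x - g.c := by linarith [Real.sqrt_nonneg p]
    exact ⟨(Real.sqrt_le_left hx).1 (by linarith), (Real.le_sqrt hx (hp.trans hpq)).1 (by linarith)⟩
  · intro hz
    refine ⟨g.c + √z, ⟨by linarith [Real.sqrt_le_sqrt hz.1], by linarith [Real.sqrt_le_sqrt hz.2]⟩,
      ?_⟩
    rw [phi, add_sub_cancel_left, Real.sq_sqrt (hp.trans hz.1)]

theorem phi_image_Icc_left (g : TData) {p q : ℝ} (hp : 0 ≤ p) (hpq : p ≤ q) :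
    g.phi '' Icc (g.c - √q) (g.c - √p) = Icc p q := by
  have phi_reflect : ∀ x, g.phi (2 * g.c - x) = g.phi x := fun x => by
    rw [phi, phi]
    ring
  have hreflect : (fun x => 2 * g.c - x) '' Icc (g.c + √p) (g.c + √q) =
      Icc (g.c - √q) (g.c - √p) := by
    rw [image_const_sub_Icc]
    congr 1 <;> ring
  rw [← g.phi_image_Icc_right hp hpq, ← hreflect, image_image]
  simp only [phi_reflect]

theorem phi_image_Icc_symm (g : TData) {r : ℝ} (hr : 0 ≤ r) :
    g.phi '' Icc (g.c - r) (g.c + r) = Icc 0 (r ^ 2) := by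
  refine Subset.antisymm ?_ ?_
  · rintro _ ⟨x, hx, rfl⟩
    exact ⟨sq_nonneg _, (g.phi_le_iff (sq_nonneg r)).2 (by rwa [Real.sqrt_sq hr])⟩
  · rw [← g.phi_image_Icc_right le_rfl (sq_nonneg r), Real.sqrt_sq hr, Real.sqrt_zero]
    exact image_mono (Icc_subset_Icc_left (by linarith))

theorem central_eq_of_mem {g : TData} {W : Set ℝ}
    (disj : ∀ U ∈ g.pieces, ∀ V ∈ g.pieces, U ≠ V → Disjoint U V) (hW : W ∈ g.pieces)
    (hc : g.c ∈ W) : g.central = W := by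
  have : {W ∈ g.pieces | g.c ∈ W} = {W} := by
    refine Set.ext fun V => ⟨fun hV => ?_, ?_⟩
    · by_contra hne
      exact disjoint_left.1 (disj V hV.1 W hW hne) hV.2 hc
    · rintro rfl
      exact ⟨hW, hc⟩
  rw [central, this, sUnion_singleton]

theorem ClassT.exists_crossExpanding {g : TData} (hg : g.ClassT) {W : Set ℝ} (hW : W ∈ g.pieces)
    (hcW : g.c ∉ W) : ∃ α β, W = Icc α β ∧ CrossExpanding g.map α β ∧ g.map '' Icc α β = g.J := by
  obtain ⟨α, β, hαβ, rfl⟩ := hg.interval W hW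
  obtain ⟨a, b, hdom, hexp, him⟩ := (hg.diff _ hW).crossExpanding
  have hphi : g.phi '' Icc α β = Icc a b := (hg.dom_noncentral _ hW hcW).symm.trans hdom
  have heq : EqOn g.map (g.diffeo (Icc α β) ∘ g.phi) (Icc α β) := hg.decomp _ hW
  refine ⟨α, β, rfl, ?_, by rw [heq.image_eq, image_comp, hphi, him]⟩
  exact (hexp.comp (.sub_sq hcW hαβ) fun x hx => hphi ▸ mem_image_of_mem g.phi hx).congr heq

theorem ClassT.isExpanding {g : TData} (hg : g.ClassT) : ∃ r R a, g.IsExpanding r R a := by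
  obtain ⟨r, R, hr, hrR, hJ, hI⟩ := hg.symm
  have hcen : g.central = Icc (g.c - r) (g.c + r) :=
    central_eq_of_mem hg.disj hI ⟨by linarith, by linarith⟩
  rw [← hcen] at hI
  obtain ⟨a, b, hdom, hexp, him⟩ := (hg.diff _ hI).crossExpanding
  obtain ⟨hsub, hhi⟩ := hg.dom_central
  rw [hcen, g.phi_image_Icc_symm hr.le, ← hcen, hdom] at hsub hhi
  rw [hi, hi, csSup_Icc hexp.lt.le, csSup_Icc (by positivity)] at hhi
  subst hhi
  exact ⟨r, R, a, hr, hrR, hJ, hcen, hI, (hsub ⟨le_rfl, by positivity⟩).1, hdom, hexp, him,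
    hg.decomp _ hI, hg.subset, hg.disj, fun W hW hne =>
      hg.exists_crossExpanding hW fun h => hne (central_eq_of_mem hg.disj hW h).symm⟩

namespace IsExpanding

variable {g : TData} {r R a : ℝ}

theorem eq_of_mem (hg : g.IsExpanding r R a) {U V : Set ℝ} {x : ℝ} (hU : U ∈ g.pieces)
    (hV : V ∈ g.pieces) (hxU : x ∈ U) (hxV : x ∈ V) : U = V := by
  by_contra h
  exact disjoint_left.1 (hg.disj U hU V hV h) hxU hxV

theorem c_mem (hg : g.IsExpanding r R a) : g.c ∈ g.central := by
  rw [hg.central_eq]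
  exact ⟨by linarith [hg.r_pos], by linarith [hg.r_pos]⟩

theorem mem_central_iff (hg : g.IsExpanding r R a) {x : ℝ} :
    x ∈ g.central ↔ g.phi x ≤ r ^ 2 := by
  rw [g.phi_le_iff (sq_nonneg r), Real.sqrt_sq hg.r_pos.le, hg.central_eq]

theorem phi_mem_Icc (hg : g.IsExpanding r R a) {x : ℝ} (hx : x ∈ g.central) :
    g.phi x ∈ Icc a (r ^ 2) :=
  ⟨hg.a_nonpos.trans (sq_nonneg _), hg.mem_central_iff.1 hx⟩

theorem map_mem_J (hg : g.IsExpanding r R a) {x : ℝ} (hx : x ∈ ⋃₀ g.pieces) : g.map x ∈ g.J := by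
  obtain ⟨W, hW, hxW⟩ := hx
  by_cases h : W = g.central
  · subst h
    rw [hg.map_central x hxW, ← hg.image_central]
    exact mem_image_of_mem _ (hg.phi_mem_Icc hxW)
  · obtain ⟨α, β, rfl, -, him⟩ := hg.branch W hW h
    exact him ▸ mem_image_of_mem _ hxW

theorem cylinder_succ (hg : g.IsExpanding r R a) {W : Set ℝ} {y : ℝ} (hW : W ∈ g.pieces)
    (hy : y ∈ W) (k : ℕ) :
    g.cylinder (k + 1) y = W ∩ g.map ⁻¹' g.cylinder k (g.map y) := by
  refine Set.ext fun u => ⟨fun ⟨_, h⟩ => ?_, fun ⟨hu, _, h⟩ => ⟨hg.subset W hW hu, fun j hj => ?_⟩⟩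
  · obtain ⟨W', hW', hyW', hu⟩ := h 0 k.succ_pos
    obtain rfl := hg.eq_of_mem hW' hW hyW' hy
    exact ⟨hu, hg.map_mem_J ⟨_, hW, hu⟩, fun j hj => h (j + 1) (by omega)⟩
  · cases j with
    | zero => exact ⟨W, hW, hy, hu⟩
    | succ j => exact h j (by omega)

theorem pullback_eq_cylinder_inter (hg : g.IsExpanding r R a) (k : ℕ) (y : ℝ) :
    g.pullback k y = g.cylinder k y ∩ g.map^[k] ⁻¹' g.central := by
  refine Set.ext fun u => ⟨fun h => ⟨⟨?_, h.1⟩, h.2⟩, fun h => ⟨h.1.2, h.2⟩⟩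
  cases k with
  | zero => exact hg.subset _ hg.central_mem h.2
  | succ k =>
    obtain ⟨W, hW, -, hu⟩ := h.1 0 k.succ_pos
    exact hg.subset W hW hu

theorem pullback_succ (hg : g.IsExpanding r R a) {y : ℝ} (hy : y ∈ g.central) (k : ℕ) :
    g.pullback (k + 1) y = g.central ∩ g.map ⁻¹' g.pullback k (g.map y) := by
  rw [hg.pullback_eq_cylinder_inter, hg.pullback_eq_cylinder_inter,
    hg.cylinder_succ hg.central_mem hy, inter_assoc]
  rfl

theorem cylinder_eq_of_mem (hg : g.IsExpanding r R a) {k : ℕ} {u y : ℝ} (h : u ∈ g.cylinder k y) :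
    g.cylinder k u = g.cylinder k y := by
  refine Set.ext fun v => and_congr_right fun _ => forall₂_congr fun j hj => ?_
  obtain ⟨W, hW, hyW, huW⟩ := h.2 j hj
  constructor
  · rintro ⟨W', hW', huW', hv⟩
    exact ⟨W, hW, hyW, hg.eq_of_mem hW' hW huW' huW ▸ hv⟩
  · rintro ⟨W', hW', hyW', hv⟩
    exact ⟨W, hW, huW, hg.eq_of_mem hW' hW hyW' hyW ▸ hv⟩

theorem pullback_eq_of_mem_cylinder (hg : g.IsExpanding r R a) {k : ℕ} {u y : ℝ}
    (h : u ∈ g.cylinder k y) : g.pullback k u = g.pullback k y := by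
  rw [hg.pullback_eq_cylinder_inter, hg.pullback_eq_cylinder_inter, hg.cylinder_eq_of_mem h]

theorem exists_cylinder_eq_Icc (hg : g.IsExpanding r R a) (k : ℕ) : ∀ y : ℝ,
    (∀ j < k, g.map^[j] y ∈ ⋃₀ g.pieces ∧ g.map^[j] y ∉ g.central) →
    ∃ α β, g.cylinder k y = Icc α β ∧ CrossExpanding g.map^[k] α β ∧
      g.map^[k] '' Icc α β = g.J := by
  induction k with
  | zero =>
    intro y _
    refine ⟨g.c - R, g.c + R, ?_, .id (by linarith [hg.r_pos, hg.r_lt]), ?_⟩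
    · simp [cylinder, ← hg.J_eq]
    · rw [Function.iterate_zero, image_id, hg.J_eq]
  | succ k ih =>
    intro y hy
    obtain ⟨α, β, hcyl, hexp, him⟩ := ih (g.map y) fun j hj => hy (j + 1) (by omega)
    obtain ⟨⟨W, hW, hyW⟩, hync⟩ := hy 0 k.succ_pos
    obtain ⟨α₀, β₀, rfl, hexp₀, him₀⟩ := hg.branch W hW fun h => hync (h ▸ hyW)
    have hsub : Icc α β ⊆ g.J := hcyl ▸ fun u hu => hu.1
    obtain ⟨hα, hβ⟩ := (Icc_subset_Icc_iff hexp.lt.le).1 (hsub.trans_eq hg.J_eq)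
    obtain ⟨p, q, hp, hpq, hq, heq⟩ :=
      hexp₀.exists_inter_preimage_Icc_eq (him₀.trans hg.J_eq) hα hexp.lt hβ
    have himpq : g.map '' Icc p q = Icc α β := by
      rw [← heq, image_inter_preimage, him₀, inter_eq_right.2 hsub]
    refine ⟨p, q, by rw [hg.cylinder_succ (y := y) hW hyW, hcyl, heq], ?_, ?_⟩ <;>
      rw [Function.iterate_succ]
    · exact hexp.comp (hexp₀.restrict hp hpq hq) fun x hx => himpq ▸ mem_image_of_mem _ hx
    · rw [image_comp, himpq, him]

end IsExpanding

end TData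

/-! ### Branches of the first return map -/

theorem ordConnectedComponent_union_eq_left {A B : Set ℝ} {x : ℝ} (hA : A.OrdConnected) (hx : x ∈ A)
    (h : ∀ y ∈ B, ∃ z ∈ uIcc x y, z ∉ A ∪ B) : ordConnectedComponent (A ∪ B) x = A := by
  refine Subset.antisymm (fun y hy => ?_) (subset_ordConnectedComponent hx subset_union_left)
  rcases ordConnectedComponent_subset hy with hyA | hyB
  · exact hyA
  · obtain ⟨z, hz, hzn⟩ := h y hyB
    exact absurd (mem_ordConnectedComponent.1 hy hz) hzn

namespace TData

/-- The diffeomorphism `g^k ∘ h₀` of the branches with return time `k + 1`. -/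
def returnDiffeo (g : TData) (k : ℕ) (z : ℝ) : ℝ := g.map^[k] (g.diffeo g.central z)

/-- The branch of the first return map through `x`, with return time `k + 1`: the map `g^k ∘ h₀`
takes `[p', q']` onto `J` and `[p, q]` onto `I`. Thus `p < 0` is allowed, for the branch at `c`. -/
structure IsReturnBranch (g : TData) (r a : ℝ) (k : ℕ) (x p' p q q' : ℝ) : Prop where
  firstReturn : g.FirstReturn x (k + 1)
  left_lt : p' < p
  lt : p < q
  lt_right : q < q'
  le_sq : q' ≤ r ^ 2
  expanding : CrossExpanding (g.returnDiffeo k) p' q'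
  image_J : g.returnDiffeo k '' Icc p' q' = g.J
  image_central : g.returnDiffeo k '' Icc p q = g.central
  cylinder_eq : Icc a (r ^ 2) ∩ g.diffeo g.central ⁻¹' g.cylinder k (g.map x) = Icc p' q'
  pullback_eq : Icc a (r ^ 2) ∩ g.diffeo g.central ⁻¹' g.pullback k (g.map x) = Icc p q
  phi_mem : g.phi x ∈ Icc p q

theorem self_mem_pullback {g : TData} {x : ℝ} {k : ℕ} (hx : g.FirstReturn x k) :
    x ∈ g.pullback k x := by
  refine ⟨fun j hj => ?_, hx.2.2.2.2⟩
  obtain ⟨W, hW, h⟩ := hx.2.2.1 j hj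
  exact ⟨W, hW, h, h⟩

theorem firstReturn_unique {g : TData} {x : ℝ} {k l : ℕ} (hk : g.FirstReturn x k)
    (hl : g.FirstReturn x l) : k = l := by
  rcases lt_trichotomy k l with h | h | h
  · exact absurd hk.2.2.2.2 (hl.2.2.2.1 k hk.2.1 h)
  · exact h
  · exact absurd hl.2.2.2.2 (hk.2.2.2.1 l hl.2.1 h)

theorem returnTime_eq {g : TData} {x : ℝ} {k : ℕ} (hk : g.FirstReturn x k) :
    g.returnTime x = k := by
  have : {k | g.FirstReturn x k} = {k} :=
    Set.ext fun l => ⟨fun h => firstReturn_unique h hk, fun h => h ▸ hk⟩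
  rw [returnTime, this, csInf_singleton]

namespace IsExpanding

variable {g : TData} {r R a : ℝ}

theorem mem_pullback_succ_iff (hg : g.IsExpanding r R a) {x u : ℝ} (hx : x ∈ g.central) (k : ℕ) :
    u ∈ g.pullback (k + 1) x ↔
      u ∈ g.central ∧ g.diffeo g.central (g.phi u) ∈ g.pullback k (g.map x) := by
  rw [hg.pullback_succ hx]
  exact and_congr_right fun hu => by rw [mem_preimage, hg.map_central u hu]

theorem exists_returnBranch (hg : g.IsExpanding r R a) {x : ℝ} {k : ℕ}
    (hx : g.FirstReturn x (k + 1)) : ∃ p' p q q', g.IsReturnBranch r a k x p' p q q' := by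
  have hrR := hg.r_lt
  have hr := hg.r_pos
  obtain ⟨α, β, hcyl, hexp, him⟩ := hg.exists_cylinder_eq_Icc k (g.map x) fun j hj =>
    ⟨hx.2.2.1 (j + 1) (by omega), hx.2.2.2.1 (j + 1) (by omega) (by omega)⟩
  have hsub : Icc α β ⊆ g.J := hcyl ▸ fun u hu => hu.1
  obtain ⟨hα, hβ⟩ := (Icc_subset_Icc_iff hexp.lt.le).1 (hsub.trans_eq hg.J_eq)
  obtain ⟨p', q', hap', hpq', hq'r, hcyl'⟩ := hg.expanding_central.exists_inter_preimage_Icc_eq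
    (hg.image_central.trans hg.J_eq) hα hexp.lt hβ
  have himh : g.diffeo g.central '' Icc p' q' = Icc α β := by
    rw [← hcyl', image_inter_preimage, hg.image_central, inter_eq_right.2 hsub]
  have hF : CrossExpanding (g.returnDiffeo k) p' q' :=
    hexp.comp (hg.expanding_central.restrict hap' hpq' hq'r)
      fun z hz => himh ▸ mem_image_of_mem _ hz
  have hFim : g.returnDiffeo k '' Icc p' q' = g.J := by
    rw [← him, ← himh, image_image]
    rfl
  obtain ⟨p, q, hp, hpq, hq, hI⟩ := hF.exists_inter_preimage_Icc_eq_of_lt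
    (α := g.c - r) (β := g.c + r) (hFim.trans hg.J_eq) (by linarith) (by linarith) (by linarith)
  rw [← hg.central_eq] at hI
  have hpull : Icc a (r ^ 2) ∩ g.diffeo g.central ⁻¹' g.pullback k (g.map x) = Icc p q := by
    rw [hg.pullback_eq_cylinder_inter, preimage_inter, ← inter_assoc, hcyl, hcyl', ← hI]
    rfl
  refine ⟨p', p, q, q', hx, hp, hpq, hq, hq'r, hF, hFim, ?_, by rw [hcyl, hcyl'], hpull, ?_⟩
  · rw [← hI, image_inter_preimage, hFim, inter_eq_right]
    exact hg.subset _ hg.central_mem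
  · rw [← hpull]
    exact ⟨hg.phi_mem_Icc hx.1, ((hg.mem_pullback_succ_iff hx.1 k).1 (self_mem_pullback hx)).2⟩

theorem pullback_eq_preimage_phi (hg : g.IsExpanding r R a) {k : ℕ} {x p' p q q' : ℝ}
    (hb : g.IsReturnBranch r a k x p' p q q') : g.pullback (k + 1) x = g.phi ⁻¹' Icc p q := by
  ext u
  rw [hg.mem_pullback_succ_iff hb.firstReturn.1, hg.mem_central_iff, mem_preimage, ← hb.pullback_eq]
  exact and_congr_left' (iff_and_self.2 fun _ => hg.a_nonpos.trans (sq_nonneg _))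

theorem firstReturn_of_mem_pullback (hg : g.IsExpanding r R a) {x u : ℝ} {k : ℕ}
    (hx : g.FirstReturn x (k + 1)) (hu : u ∈ g.pullback (k + 1) x) :
    g.FirstReturn u (k + 1) := by
  refine ⟨((hg.mem_pullback_succ_iff hx.1 k).1 hu).1, k.succ_pos, fun j hj => ?_,
    fun j h0 hj h => ?_, hu.2⟩
  · obtain ⟨W, hW, -, h⟩ := hu.1 j hj
    exact ⟨W, hW, h⟩
  · obtain ⟨W, hW, hxW, huW⟩ := hu.1 j hj
    exact hx.2.2.2.1 j h0 hj (hg.eq_of_mem hW hg.central_mem huW h ▸ hxW)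

theorem map_mem_cylinder (hg : g.IsExpanding r R a) {x u : ℝ} {k : ℕ}
    (hx : x ∈ g.central) (hu : u ∈ g.pullback (k + 1) x) : g.map u ∈ g.cylinder k (g.map x) := by
  rw [hg.pullback_succ hx, hg.pullback_eq_cylinder_inter] at hu
  exact hu.2.1

theorem pullback_succ_congr (hg : g.IsExpanding r R a) {x u : ℝ} {k : ℕ}
    (hx : x ∈ g.central) (hu : u ∈ g.pullback (k + 1) x) :
    g.pullback (k + 1) u = g.pullback (k + 1) x := by
  rw [hg.pullback_succ hx, hg.pullback_succ ((hg.mem_pullback_succ_iff hx k).1 hu).1,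
    hg.pullback_eq_of_mem_cylinder (hg.map_mem_cylinder hx hu)]

theorem eq_of_mem_cylinder_of_mem_pullback (hg : g.IsExpanding r R a) {x x' u : ℝ} {k k' : ℕ}
    (hx : g.FirstReturn x (k + 1)) (hk : k' ≤ k)
    (hu : u ∈ g.cylinder k (g.map x)) (hu' : u ∈ g.pullback k' (g.map x')) :
    k' = k ∧ g.pullback k (g.map x) = g.pullback k' (g.map x') := by
  -- If `k' < k`, the orbit of `x` would enter `I` together with that of `u`, at time `k' + 1`.
  have hkk : k' = k := by
    by_contra hne
    obtain ⟨W, hW, hxW, huW⟩ := hu.2 k' (lt_of_le_of_ne hk hne)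
    exact hx.2.2.2.1 (k' + 1) k'.succ_pos (by omega)
      (hg.eq_of_mem hW hg.central_mem huW hu'.2 ▸ hxW)
  subst hkk
  rw [hg.pullback_eq_cylinder_inter] at hu'
  exact ⟨rfl, by rw [← hg.pullback_eq_of_mem_cylinder hu, ← hg.pullback_eq_of_mem_cylinder hu'.1]⟩

theorem exists_returnBranch_of_mem_pieces (hg : g.IsExpanding r R a) {W : Set ℝ}
    (hW : W ∈ g.prerenorm.pieces) {u : ℝ} (hu : u ∈ W) :
    ∃ k p' p q q', g.IsReturnBranch r a k u p' p q q' ∧ W = g.component (k + 1) u := by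
  obtain ⟨⟨x, k, hx, rfl⟩, -⟩ := hW
  obtain ⟨k, rfl⟩ := Nat.exists_eq_succ_of_ne_zero hx.2.1.ne'
  have hup : u ∈ g.pullback (k + 1) x := ordConnectedComponent_subset hu
  obtain ⟨p', p, q, q', hb⟩ := hg.exists_returnBranch (hg.firstReturn_of_mem_pullback hx hup)
  refine ⟨k, p', p, q, q', hb, ?_⟩
  rw [component, component, hg.pullback_succ_congr hx.1 hup]
  exact ordConnectedComponent_eq hu

theorem component_eq (hg : g.IsExpanding r R a) {k : ℕ} {x p' p q q' : ℝ}
    (hb : g.IsReturnBranch r a k x p' p q q') :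
    (p ≤ 0 ∧ g.component (k + 1) x = Icc (g.c - √q) (g.c + √q)) ∨
    (0 < p ∧ (g.component (k + 1) x = Icc (g.c + √p) (g.c + √q) ∨
      g.component (k + 1) x = Icc (g.c - √q) (g.c - √p))) := by
  have hx := hb.phi_mem
  have hq : 0 ≤ q := (sq_nonneg _).trans hx.2
  rw [component, hg.pullback_eq_preimage_phi hb]
  rcases le_or_gt p 0 with hp | hp
  · refine .inl ⟨hp, ?_⟩
    have heq : g.phi ⁻¹' Icc p q = Icc (g.c - √q) (g.c + √q) := Set.ext fun u =>
      (and_iff_right (hp.trans (sq_nonneg _))).trans (g.phi_le_iff hq)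
    have hx' : x ∈ Icc (g.c - √q) (g.c + √q) := heq ▸ hx
    rw [heq]
    exact ordConnectedComponent_subset.antisymm (subset_ordConnectedComponent hx' Subset.rfl)
  · refine .inr ⟨hp, ?_⟩
    have hsp := Real.sqrt_pos.2 hp
    have heq : g.phi ⁻¹' Icc p q = Icc (g.c + √p) (g.c + √q) ∪ Icc (g.c - √q) (g.c - √p) :=
      Set.ext fun u => g.phi_mem_Icc_iff hp hq
    have hc : g.c ∉ Icc (g.c + √p) (g.c + √q) ∪ Icc (g.c - √q) (g.c - √p) := by
      rintro (h | h) <;> linarith [h.1, h.2]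
    rw [heq]
    rcases (g.phi_mem_Icc_iff hp hq).1 hx with hx | hx
    · refine .inl (ordConnectedComponent_union_eq_left ordConnected_Icc hx fun y hy =>
        ⟨g.c, mem_uIcc.2 (.inr ?_), hc⟩)
      constructor <;> linarith [hx.1, hy.2]
    · rw [union_comm] at hc ⊢
      refine .inr (ordConnectedComponent_union_eq_left ordConnected_Icc hx fun y hy =>
        ⟨g.c, mem_uIcc.2 (.inl ?_), hc⟩)
      constructor <;> linarith [hx.2, hy.1]

theorem exists_component_eq_Icc (hg : g.IsExpanding r R a) {k : ℕ} {x p' p q q' : ℝ}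
    (hb : g.IsReturnBranch r a k x p' p q q') (hc : g.c ∉ g.component (k + 1) x) :
    ∃ α β, α < β ∧ g.component (k + 1) x = Icc α β ∧ g.phi '' Icc α β = Icc p q := by
  have hq := Real.sqrt_nonneg q
  rcases hg.component_eq hb with ⟨-, h⟩ | ⟨hp, h | h⟩
  · rw [h] at hc
    exact absurd ⟨by linarith, by linarith⟩ hc
  all_goals have hlt := Real.sqrt_lt_sqrt hp.le hb.lt
  · exact ⟨_, _, by linarith, h, g.phi_image_Icc_right hp.le hb.lt.le⟩
  · exact ⟨_, _, by linarith, h, g.phi_image_Icc_left hp.le hb.lt.le⟩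

end IsExpanding

end TData

/-! ### The critical orbit -/

namespace TData

namespace IsExpanding

variable {g : TData} {r R a : ℝ}

theorem central_mem_nhds (hg : g.IsExpanding r R a) : g.central ∈ 𝓝 g.c := by
  rw [hg.central_eq]
  exact Icc_mem_nhds (by linarith [hg.r_pos]) (by linarith [hg.r_pos])

theorem map_mem_boundary (hg : g.IsExpanding r R a) {W : Set ℝ} (hW : W ∈ g.pieces) {u : ℝ}
    (hu : u ∈ W) (hui : u ∉ interior W) : g.map u = g.c - R ∨ g.map u = g.c + R := by
  by_cases h : W = g.central
  · subst h
    have hphi : g.phi u = r ^ 2 := by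
      rw [hg.central_eq] at hu hui
      rw [interior_Icc] at hui
      rw [phi]
      rcases eq_endpoints_or_mem_Ioo_of_mem_Icc hu with rfl | rfl | h
      · ring
      · ring
      · exact absurd h hui
    rw [hg.map_central u hu, hphi]
    rcases hg.expanding_central.image_endpoints (hg.image_central.trans hg.J_eq) with h | h
    · exact .inr h.2
    · exact .inl h.2
  · obtain ⟨α, β, rfl, hexp, him⟩ := hg.branch W hW h
    rw [interior_Icc] at hui
    rcases eq_endpoints_or_mem_Ioo_of_mem_Icc hu with rfl | rfl | h
    · exact (hexp.image_endpoints (him.trans hg.J_eq)).imp And.left And.left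
    · exact (hexp.image_endpoints (him.trans hg.J_eq)).symm.imp And.right And.right
    · exact absurd h hui

theorem crit_notMem_boundary (hg : g.IsExpanding r R a) (hrec : g.Recurrent) (n : ℕ) :
    ¬ (g.map^[n] g.c = g.c - R ∨ g.map^[n] g.c = g.c + R) := by
  -- The boundary of `J` is forward invariant, as long as the orbit is defined.
  intro h
  have hR : 0 < R := hg.r_pos.trans hg.r_lt
  have hinv : ∀ m, g.map^[m + n] g.c = g.c - R ∨ g.map^[m + n] g.c = g.c + R := by
    intro m
    induction m with
    | zero => rwa [zero_add]
    | succ m ih =>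
      obtain ⟨W, hW, hmem⟩ := hrec.1 (m + n)
      rw [Nat.succ_add, Function.iterate_succ_apply']
      refine hg.map_mem_boundary hW hmem fun hi => ?_
      have := interior_mono (hg.subset W hW) hi
      rw [hg.J_eq, interior_Icc] at this
      rcases ih with h | h <;> rw [h] at this
      · exact this.1.ne rfl
      · exact this.2.ne rfl
  have hfreq := mapClusterPt_iff_frequently.1 hrec.2 (Ioo (g.c - R) (g.c + R))
    (Ioo_mem_nhds (by linarith) (by linarith))
  obtain ⟨m, hm, hmem⟩ := frequently_atTop.1 hfreq n
  obtain ⟨k, rfl⟩ := Nat.exists_eq_add_of_le' hm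
  rcases hinv k with h | h <;> rw [h] at hmem
  · exact hmem.1.ne rfl
  · exact hmem.2.ne rfl

theorem crit_mem_interior (hg : g.IsExpanding r R a) (hrec : g.Recurrent) (n : ℕ) {W : Set ℝ}
    (hW : W ∈ g.pieces) (h : g.map^[n] g.c ∈ W) : g.map^[n] g.c ∈ interior W := by
  by_contra hi
  have := hg.map_mem_boundary hW h hi
  rw [← Function.iterate_succ_apply' g.map] at this
  exact hg.crit_notMem_boundary hrec (n + 1) this

theorem continuousAt_map (hg : g.IsExpanding r R a) {W : Set ℝ} (hW : W ∈ g.pieces) {u : ℝ}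
    (hu : u ∈ interior W) : ContinuousAt g.map u := by
  suffices h : ContinuousOn g.map W from h.continuousAt (mem_interior_iff_mem_nhds.1 hu)
  by_cases h : W = g.central
  · subst h
    refine (hg.expanding_central.continuousOn.comp ?_ fun x hx => hg.phi_mem_Icc hx).congr
      hg.map_central
    exact ((continuous_id.sub continuous_const).pow 2).continuousOn
  · obtain ⟨α, β, rfl, hexp, -⟩ := hg.branch W hW h
    exact hexp.continuousOn

theorem continuousAt_iterate (hg : g.IsExpanding r R a) (hrec : g.Recurrent) (n : ℕ) :
    ContinuousAt g.map^[n] g.c := by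
  induction n with
  | zero => exact continuousAt_id
  | succ n ih =>
    rw [Function.iterate_succ']
    obtain ⟨W, hW, h⟩ := hrec.1 n
    exact (hg.continuousAt_map hW (hg.crit_mem_interior hrec n hW h)).comp ih

theorem iterate_mem_omegaCrit (hg : g.IsExpanding r R a) (hrec : g.Recurrent) (n : ℕ) :
    g.map^[n] g.c ∈ g.omegaCrit := by
  have h : MapClusterPt (g.map^[n] g.c) atTop (fun m : ℕ => g.map^[n] (g.map^[m] g.c)) :=
    MapClusterPt.continuousAt_comp (hg.continuousAt_iterate hrec n) hrec.2
  simp only [← Function.iterate_add_apply] at h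
  exact h.of_comp (φ := fun m => n + m) (tendsto_add_atTop_nat n |>.congr fun m => add_comm m n)

end IsExpanding

theorem Recurrent.exists_lt_iterate_mem {g : TData} (hrec : g.Recurrent) {U : Set ℝ}
    (hU : U ∈ 𝓝 g.c) (n : ℕ) : ∃ m, n < m ∧ g.map^[m] g.c ∈ U :=
  frequently_atTop.1 (mapClusterPt_iff_frequently.1 hrec.2 U hU) (n + 1)

theorem Recurrent.exists_firstReturn_le {g : TData} (hrec : g.Recurrent) {n m : ℕ}
    (hn : g.map^[n] g.c ∈ g.central) (hnm : n < m) (hm : g.map^[m] g.c ∈ g.central) :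
    ∃ k, g.FirstReturn (g.map^[n] g.c) (k + 1) ∧ k + 1 + n ≤ m := by
  classical
  have hex : ∃ k, g.map^[k + 1 + n] g.c ∈ g.central :=
    ⟨m - n - 1, by rwa [Nat.sub_add_cancel (by omega), Nat.sub_add_cancel hnm.le]⟩
  have hmin : Nat.find hex ≤ m - n - 1 :=
    Nat.find_min' hex (by rwa [Nat.sub_add_cancel (by omega), Nat.sub_add_cancel hnm.le])
  refine ⟨Nat.find hex, ⟨hn, Nat.succ_pos _, fun j _ => ?_, fun j hj₀ hj h => ?_, ?_⟩, by omega⟩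
  · rw [← Function.iterate_add_apply]
    exact hrec.1 _
  · obtain ⟨i, rfl⟩ := Nat.exists_eq_succ_of_ne_zero hj₀.ne'
    rw [← Function.iterate_add_apply] at h
    exact Nat.find_min hex (Nat.succ_lt_succ_iff.1 hj) h
  · rw [← Function.iterate_add_apply]
    exact Nat.find_spec hex

theorem prerenorm_map_of_firstReturn {g : TData} {x : ℝ} {k : ℕ} (hx : g.FirstReturn x k) :
    g.prerenorm.map x = g.map^[k] x := by
  change g.map^[g.returnTime x] x = _
  rw [returnTime_eq hx]

namespace IsExpanding

variable {g : TData} {r R a : ℝ}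

theorem exists_firstReturn (hg : g.IsExpanding r R a) (hrec : g.Recurrent) {n : ℕ}
    (hn : g.map^[n] g.c ∈ g.central) : ∃ k, g.FirstReturn (g.map^[n] g.c) (k + 1) := by
  obtain ⟨m, hm, h⟩ := hrec.exists_lt_iterate_mem hg.central_mem_nhds n
  exact (hrec.exists_firstReturn_le hn hm h).imp fun _ => And.left

/-! ### Recurrence of the pre-renormalization -/

theorem self_mem_component {x : ℝ} {k : ℕ} (hx : g.FirstReturn x k) : x ∈ g.component k x :=
  self_mem_ordConnectedComponent.2 (self_mem_pullback hx)

theorem component_mem_pieces (hg : g.IsExpanding r R a) (hrec : g.Recurrent) {n k : ℕ}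
    (hk : g.FirstReturn (g.map^[n] g.c) k) :
    g.component k (g.map^[n] g.c) ∈ g.prerenorm.pieces :=
  ⟨⟨_, _, hk, rfl⟩, _, self_mem_component hk, hg.iterate_mem_omegaCrit hrec n⟩

theorem exists_prerenorm_iterate_eq (hg : g.IsExpanding r R a) (hrec : g.Recurrent) (i : ℕ) :
    ∃ n, g.prerenorm.map^[i] g.c = g.map^[n] g.c ∧ g.map^[n] g.c ∈ g.central := by
  induction i with
  | zero => exact ⟨0, rfl, hg.c_mem⟩
  | succ i ih =>
    obtain ⟨n, hin, hn⟩ := ih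
    obtain ⟨k, hk⟩ := hg.exists_firstReturn hrec hn
    refine ⟨k + 1 + n, ?_, ?_⟩
    · rw [Function.iterate_succ_apply', hin, prerenorm_map_of_firstReturn hk,
        ← Function.iterate_add_apply]
    · rw [Function.iterate_add_apply]
      exact hk.2.2.2.2

theorem exists_le_prerenorm_iterate_eq (hrec : g.Recurrent) (d : ℕ) :
    ∀ i n, g.prerenorm.map^[i] g.c = g.map^[n] g.c → g.map^[n] g.c ∈ g.central →
      g.map^[d + n] g.c ∈ g.central → ∃ j ≥ i, g.prerenorm.map^[j] g.c = g.map^[d + n] g.c := by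
  induction d using Nat.strong_induction_on with
  | _ d ih =>
    intro i n hin hn hd
    rcases Nat.eq_zero_or_pos d with rfl | hd₀
    · exact ⟨i, le_rfl, by rwa [zero_add]⟩
    obtain ⟨k, hk, hle⟩ := hrec.exists_firstReturn_le hn (Nat.lt_add_of_pos_left hd₀) hd
    obtain ⟨d, rfl⟩ := Nat.exists_eq_add_of_le' (Nat.le_of_add_le_add_right hle)
    rw [add_assoc] at hd ⊢
    obtain ⟨j, hj, hje⟩ := ih d (by omega) (i + 1) (k + 1 + n)
      (by rw [Function.iterate_succ_apply', hin, prerenorm_map_of_firstReturn hk,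
        ← Function.iterate_add_apply])
      (by rw [Function.iterate_add_apply]; exact hk.2.2.2.2) hd
    exact ⟨j, (Nat.le_succ i).trans hj, hje⟩

theorem recurrent_prerenorm (hg : g.IsExpanding r R a) (hrec : g.Recurrent) :
    g.prerenorm.Recurrent := by
  refine ⟨fun i => ?_, mapClusterPt_iff_frequently.2 fun U hU => frequently_atTop.2 fun i => ?_⟩
  all_goals obtain ⟨n, hin, hn⟩ := hg.exists_prerenorm_iterate_eq hrec i
  · obtain ⟨k, hk⟩ := hg.exists_firstReturn hrec hn
    change g.prerenorm.map^[i] g.c ∈ _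
    rw [hin]
    exact ⟨_, hg.component_mem_pieces hrec hk, self_mem_component hk⟩
  · obtain ⟨m, hm, hmU, hmI⟩ :=
      hrec.exists_lt_iterate_mem (inter_mem hU hg.central_mem_nhds) n
    obtain ⟨d, rfl⟩ := Nat.exists_eq_add_of_le' hm.le
    obtain ⟨j, hj, hje⟩ := exists_le_prerenorm_iterate_eq hrec d i n hin hn hmI
    refine ⟨j, hj, ?_⟩
    change g.prerenorm.map^[j] g.c ∈ U
    rwa [hje]

/-! ### Branches of the pre-renormalization -/

theorem prerenorm_diffeo (hg : g.IsExpanding r R a) {x : ℝ} {k : ℕ}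
    (hx : g.FirstReturn x (k + 1)) :
    g.prerenorm.diffeo (g.component (k + 1) x) = g.returnDiffeo k := by
  have : g.returnTime '' g.component (k + 1) x = {k + 1} := by
    refine Subset.antisymm ?_ ?_
    · rintro _ ⟨u, hu, rfl⟩
      exact returnTime_eq (hg.firstReturn_of_mem_pullback hx (ordConnectedComponent_subset hu))
    · rintro _ rfl
      exact ⟨x, self_mem_component hx, returnTime_eq hx⟩
  change (fun z => g.map^[sInf (g.returnTime '' g.component (k + 1) x) - 1] _) = _
  rw [this, csInf_singleton, Nat.add_sub_cancel]
  rfl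

theorem prerenorm_dom (hg : g.IsExpanding r R a) {k : ℕ} {x p' p q q' : ℝ}
    (hb : g.IsReturnBranch r a k x p' p q q') :
    g.prerenorm.dom (g.component (k + 1) x) = Icc p q := by
  have hx := hb.firstReturn
  change {z ∈ g.dom g.central | ∃ u ∈ g.component (k + 1) x, ∃ l, g.FirstReturn u l ∧
    g.diffeo g.central z ∈ g.pullback (l - 1) (g.map u)} = _
  rw [hg.dom_eq, ← hb.pullback_eq]
  refine Set.ext fun z => and_congr_right fun _ => ⟨?_, fun hz => ?_⟩
  · rintro ⟨u, hu, l, hl, hzl⟩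
    have hup := ordConnectedComponent_subset hu
    obtain rfl := firstReturn_unique hl (hg.firstReturn_of_mem_pullback hx hup)
    rwa [Nat.add_sub_cancel, hg.pullback_eq_of_mem_cylinder (hg.map_mem_cylinder hx.1 hup)] at hzl
  · exact ⟨x, self_mem_component hx, k + 1, hx, hz⟩

theorem prerenorm_map_eq (hg : g.IsExpanding r R a) {x : ℝ} {k : ℕ}
    (hx : g.FirstReturn x (k + 1)) :
    EqOn g.prerenorm.map (g.returnDiffeo k ∘ g.phi) (g.component (k + 1) x) := fun u hu => by
  have h := hg.firstReturn_of_mem_pullback hx (ordConnectedComponent_subset hu)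
  rw [prerenorm_map_of_firstReturn h, Function.iterate_succ_apply, hg.map_central u h.1]
  rfl

theorem prerenorm_subset (hg : g.IsExpanding r R a) {W : Set ℝ} (hW : W ∈ g.prerenorm.pieces) :
    W ⊆ g.central := fun u hu => by
  obtain ⟨k, p', p, q, q', hb, -⟩ := hg.exists_returnBranch_of_mem_pieces hW hu
  exact hb.firstReturn.1

theorem prerenorm_disjoint (hg : g.IsExpanding r R a) {U V : Set ℝ} (hU : U ∈ g.prerenorm.pieces)
    (hV : V ∈ g.prerenorm.pieces) (hne : U ≠ V) : Disjoint U V := by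
  refine disjoint_left.2 fun u hu hv => hne ?_
  obtain ⟨k, _, _, _, _, hk, rfl⟩ := hg.exists_returnBranch_of_mem_pieces hU hu
  obtain ⟨l, _, _, _, _, hl, rfl⟩ := hg.exists_returnBranch_of_mem_pieces hV hv
  rw [firstReturn_unique hk.firstReturn hl.firstReturn]

theorem right_pos (hg : g.IsExpanding r R a) (hrec : g.Recurrent) {k : ℕ} {x p' p q q' : ℝ}
    (hb : g.IsReturnBranch r a k x p' p q q') : 0 < q := by
  -- Otherwise `x = c`, and `c` is mapped to the boundary of `I`.
  have hphi : 0 ≤ g.phi x := sq_nonneg _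
  refine lt_of_le_of_ne (hphi.trans hb.phi_mem.2) fun hq => ?_
  have hx0 : g.phi x = 0 := le_antisymm (hq ▸ hb.phi_mem.2) hphi
  obtain rfl : x = g.c := sub_eq_zero.1 (pow_eq_zero_iff two_ne_zero |>.1 hx0)
  have hret : g.returnDiffeo k q ∈ Ioo (g.c - r) (g.c + r) := by
    have := hg.crit_mem_interior hrec (k + 1) hg.central_mem hb.firstReturn.2.2.2.2
    rw [Function.iterate_succ_apply, hg.map_central _ hg.c_mem, hx0, hq] at this
    rwa [← interior_Icc, ← hg.central_eq]
  have hF := hb.expanding.restrict hb.left_lt.le hb.lt hb.lt_right.le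
  rcases hF.image_endpoints (hb.image_central.trans hg.central_eq) with h | h
  · exact absurd h.2 hret.2.ne
  · exact absurd h.2 hret.1.ne'

theorem exists_crit_returnBranch (hg : g.IsExpanding r R a) (hrec : g.Recurrent) :
    ∃ k p' p q q', g.IsReturnBranch r a k g.c p' p q q' ∧ p ≤ 0 ∧ 0 < q ∧
      g.component (k + 1) g.c = Icc (g.c - √q) (g.c + √q) ∧
      g.component (k + 1) g.c ∈ g.prerenorm.pieces ∧
      g.prerenorm.central = g.component (k + 1) g.c := by
  obtain ⟨k, hk⟩ := hg.exists_firstReturn hrec (n := 0) hg.c_mem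
  have hpiece : g.component (k + 1) g.c ∈ g.prerenorm.pieces := hg.component_mem_pieces hrec hk
  obtain ⟨p', p, q, q', hb⟩ := hg.exists_returnBranch hk
  have hp : p ≤ 0 := by
    simpa only [Function.iterate_zero, id_eq, phi, sub_self, ne_eq, OfNat.ofNat_ne_zero,
      not_false_eq_true, zero_pow] using hb.phi_mem.1
  refine ⟨k, p', p, q, q', hb, hp, hg.right_pos hrec hb, ?_, hpiece, ?_⟩
  · rcases hg.component_eq hb with h | h
    · exact h.2
    · exact absurd hp h.1.not_ge
  · exact central_eq_of_mem (fun U hU V hV => hg.prerenorm_disjoint hU hV) hpiece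
      (self_mem_component hk)

theorem exists_prerenorm_crossExpanding (hg : g.IsExpanding r R a) {W : Set ℝ}
    (hW : W ∈ g.prerenorm.pieces) (hcW : g.c ∉ W) : ∃ α β, W = Icc α β ∧
      CrossExpanding g.prerenorm.map α β ∧ g.prerenorm.map '' Icc α β = g.central := by
  obtain ⟨u, hu⟩ := hW.2.left
  obtain ⟨k, p', p, q, q', hb, rfl⟩ := hg.exists_returnBranch_of_mem_pieces hW hu
  obtain ⟨α, β, hαβ, hcomp, himg⟩ := hg.exists_component_eq_Icc hb hcW
  have hmap := hg.prerenorm_map_eq hb.firstReturn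
  rw [hcomp] at hmap hcW
  refine ⟨α, β, hcomp, ?_, by rw [hmap.image_eq, image_comp, himg, hb.image_central]⟩
  exact ((hb.expanding.restrict hb.left_lt.le hb.lt hb.lt_right.le).comp (.sub_sq hcW hαβ)
    fun x hx => himg ▸ mem_image_of_mem g.phi hx).congr hmap

theorem prerenorm (hg : g.IsExpanding r R a) (hrec : g.Recurrent) :
    ∃ r' a', g.prerenorm.IsExpanding r' r a' := by
  obtain ⟨k, p', p, q, q', hb, hp, hq, hcomp, hpiece, hcen⟩ := hg.exists_crit_returnBranch hrec
  have hsq := Real.sq_sqrt hq.le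
  refine ⟨√q, p, Real.sqrt_pos.2 hq, ?_, hg.central_eq, hcen.trans hcomp, hcen ▸ hpiece, hp, ?_,
    ?_, ?_, ?_, fun W => hg.prerenorm_subset, fun U hU V hV => hg.prerenorm_disjoint hU hV,
    fun W hW hne => hg.exists_prerenorm_crossExpanding hW fun hcW => hne ?_⟩
  · rw [Real.sqrt_lt' hg.r_pos]
    exact hb.lt_right.trans_le hb.le_sq
  · rw [hcen, hg.prerenorm_dom hb, hsq]
  · rw [hcen, hg.prerenorm_diffeo hb.firstReturn, hsq]
    exact hb.expanding.restrict hb.left_lt.le hb.lt hb.lt_right.le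
  · rw [hcen, hg.prerenorm_diffeo hb.firstReturn, hsq]
    exact hb.image_central
  · rw [hcen, hg.prerenorm_diffeo hb.firstReturn]
    exact hg.prerenorm_map_eq hb.firstReturn
  · exact (central_eq_of_mem (fun U hU V hV => hg.prerenorm_disjoint hU hV) hW hcW).symm

theorem level (hg : g.IsExpanding r R a) (hrec : g.Recurrent) (n : ℕ) :
    (∃ r R a, (g.level n).IsExpanding r R a) ∧ (g.level n).Recurrent := by
  induction n with
  | zero => exact ⟨⟨r, R, a, hg⟩, hrec⟩
  | succ n ih =>
    obtain ⟨⟨r, R, a, hn⟩, hrecn⟩ := ih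
    obtain ⟨r', a', hn'⟩ := hn.prerenorm hrecn
    exact ⟨⟨r', r, a', hn'⟩, hn.recurrent_prerenorm hrecn⟩

end IsExpanding

end TData

/-! ### Comparison of lengths -/

theorem CrossExpanding.preimage_crossRatio_le {f : ℝ → ℝ} {a b p q A B α β : ℝ}
    (hf : CrossExpanding f a b) (him : f '' Icc a b = Icc A B) (himpq : f '' Icc p q = Icc α β)
    (hap : a < p) (hpq : p < q) (hqb : q < b) :
    (q - p) * (b - a) * ((α - A) * (B - β)) ≤ (β - α) * (B - A) * ((p - a) * (b - q)) := by
  have hslope := hf.slope_mul_slope_le le_rfl hap hpq hqb le_rfl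
  simp only [slope_def_field, abs_div, abs_of_pos (sub_pos.2 hap), abs_of_pos (sub_pos.2 hpq),
    abs_of_pos (sub_pos.2 hqb), abs_of_pos (sub_pos.2 hf.lt)] at hslope
  rw [div_mul_div_comm, div_mul_div_comm, div_le_div_iff₀
    (mul_pos (sub_pos.2 hap) (sub_pos.2 hqb)) (mul_pos (sub_pos.2 hpq) (sub_pos.2 hf.lt))] at hslope
  have ha : a ∈ Icc a b := left_mem_Icc.2 hf.lt.le
  have hp : p ∈ Icc a b := ⟨hap.le, (hpq.trans hqb).le⟩
  have hq : q ∈ Icc a b := ⟨(hap.trans hpq).le, hqb.le⟩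
  have hb : b ∈ Icc a b := right_mem_Icc.2 hf.lt.le
  have hAB : A ≤ B := nonempty_Icc.1 (him ▸ (nonempty_Icc.2 hf.lt.le).image f)
  have hαβ : α ≤ β := nonempty_Icc.1 (himpq ▸ (nonempty_Icc.2 hpq.le).image f)
  have hends := hf.image_endpoints him
  have hends' := (hf.restrict hap.le hpq hqb.le).image_endpoints himpq
  rcases hf.strictMonoOn_or_strictAntiOn with hmono | hanti
  · have h₁ := hmono ha hp hap
    have h₂ := hmono hp hq hpq
    have h₃ := hmono hq hb hqb
    obtain ⟨rfl, rfl⟩ : f a = A ∧ f b = B := hends.resolve_right fun h => by linarith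
    obtain ⟨rfl, rfl⟩ : f p = α ∧ f q = β := hends'.resolve_right fun h => by linarith
    rw [abs_of_pos (sub_pos.2 h₁), abs_of_pos (sub_pos.2 h₂), abs_of_pos (sub_pos.2 h₃),
      abs_of_pos (by linarith)] at hslope
    linarith
  · have h₁ := hanti ha hp hap
    have h₂ := hanti hp hq hpq
    have h₃ := hanti hq hb hqb
    obtain ⟨rfl, rfl⟩ : f a = B ∧ f b = A := hends.resolve_left fun h => by linarith
    obtain ⟨rfl, rfl⟩ : f p = β ∧ f q = α := hends'.resolve_left fun h => by linarith
    rw [abs_of_neg (sub_neg.2 h₁), abs_of_neg (sub_neg.2 h₂), abs_of_neg (sub_neg.2 h₃),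
      abs_of_neg (by linarith)] at hslope
    linarith

theorem le_mul_of_mul_le_mul_mul {θ x y u v : ℝ} (hv : 0 < v) (hx : 0 ≤ x) (hvy : v ≤ y)
    (h : x * y ≤ θ * (u * v)) : x ≤ θ * u := by
  have hxv : x * v ≤ x * y := mul_le_mul_of_nonneg_left hvy hx
  exact le_of_mul_le_mul_right (by linarith) hv

theorem sub_le_mul_sub_of_sq_sub_sq_le {θ s t r : ℝ} (hθ : 0 ≤ θ) (hs : 0 ≤ s)
    (htr : t ≤ r) (h : t ^ 2 - s ^ 2 ≤ θ * (r ^ 2 - t ^ 2)) :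
    t - s ≤ (2 * θ + √θ) * (r - t) := by
  by_contra! hlt
  have hθr : 0 ≤ θ * (r - t) := mul_nonneg hθ (sub_nonneg.2 htr)
  have hsqrt : 0 ≤ √θ * (r - t) := mul_nonneg (Real.sqrt_nonneg θ) (sub_nonneg.2 htr)
  have hsum : √θ * (r - t) < t + s := by linarith
  have hdiff : √θ * (r - t) < t - s - 2 * θ * (r - t) := by linarith
  have hprod := mul_lt_mul'' hsum hdiff hsqrt hsqrt
  have hsq : √θ * (r - t) * (√θ * (r - t)) = θ * (r - t) ^ 2 := by
    rw [mul_mul_mul_comm, Real.mul_self_sqrt hθ, sq]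
  linarith [mul_nonneg hθr hs]

theorem sub_le_sqrt_mul_sub_of_sq_sub_sq_le {θ s t u : ℝ} (hθ : 0 ≤ θ) (hs : 0 ≤ s) (hst : s < t)
    (htu : t ≤ u) (h : t ^ 2 - s ^ 2 ≤ θ * (u ^ 2 - t ^ 2)) : t - s ≤ √θ * (u - s) := by
  have hus : 0 < u - s := by linarith
  have hpos : 0 < u ^ 2 - s ^ 2 := by
    rw [sq_sub_sq]
    exact mul_pos (by linarith) hus
  have hfrac : (t - s) * (u + s) ≤ (u - s) * (t + s) := by
    linarith [mul_nonneg hs (sub_nonneg.2 htu)]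
  have hsq : (t - s) ^ 2 ≤ θ * (u - s) ^ 2 := by
    refine le_of_mul_le_mul_right ?_ hpos
    calc (t - s) ^ 2 * (u ^ 2 - s ^ 2) = (u - s) * (t - s) * ((t - s) * (u + s)) := by ring
      _ ≤ (u - s) * (t - s) * ((u - s) * (t + s)) :=
        mul_le_mul_of_nonneg_left hfrac (mul_nonneg hus.le (sub_nonneg.2 hst.le))
      _ = (u - s) ^ 2 * (t ^ 2 - s ^ 2) := by ring
      _ ≤ (u - s) ^ 2 * (θ * (u ^ 2 - s ^ 2)) := by
        refine mul_le_mul_of_nonneg_left (h.trans (mul_le_mul_of_nonneg_left ?_ hθ)) (sq_nonneg _)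
        linarith [pow_le_pow_left₀ hs hst.le 2]
      _ = θ * (u - s) ^ 2 * (u ^ 2 - s ^ 2) := by ring
  rw [← Real.sqrt_sq hus.le, ← Real.sqrt_mul hθ]
  exact Real.le_sqrt_of_sq_le hsq

theorem sqrt_div_le_sqrt {q r M : ℝ} (hr : 0 < r) (h : q ≤ M * r ^ 2) : √q / r ≤ √M := by
  rw [div_le_iff₀ hr]
  calc √q ≤ √(M * r ^ 2) := Real.sqrt_le_sqrt h
    _ = √M * r := by rw [Real.sqrt_mul' _ (sq_nonneg r), Real.sqrt_sq hr.le]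

/-! ### Poincaré lengths of intervals -/

theorem lo_Icc {a b : ℝ} (h : a ≤ b) : lo (Icc a b) = a := csInf_Icc h

theorem hi_Icc {a b : ℝ} (h : a ≤ b) : hi (Icc a b) = b := csSup_Icc h

theorem len_Icc {a b : ℝ} (h : a ≤ b) : len (Icc a b) = b - a := by rw [len, lo_Icc h, hi_Icc h]

theorem logRatio_le {x y A : ℝ} (hy : 0 < y) (hx : 0 ≤ x) (h : x ≤ A * y) :
    logRatio x y ≤ ENNReal.ofReal A := by
  rw [logRatio, if_pos hy]
  have hlog := Real.log_le_sub_one_of_pos (add_pos_of_pos_of_nonneg one_pos (div_nonneg hx hy.le))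
  exact ENNReal.ofReal_le_ofReal (by linarith [(div_le_iff₀ hy).2 h])

theorem le_logRatio {x y B : ℝ} (hy : 0 < y) (hB : 0 < B) (h : y ≤ B * (x + y)) :
    ENNReal.ofReal (Real.log (1 / B)) ≤ logRatio x y := by
  rw [logRatio, if_pos hy]
  refine ENNReal.ofReal_le_ofReal (Real.log_le_log (by positivity) ?_)
  rw [one_add_div hy.ne', div_le_div_iff₀ hB hy]
  linarith

theorem logRatio_ne_top_iff {x y : ℝ} : logRatio x y ≠ ⊤ ↔ 0 < y := by
  rw [logRatio]
  split_ifs with h <;> simp [h]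

theorem poincareLength_Icc_le {α β A B M : ℝ} (hα : A < α) (hαβ : α ≤ β) (hβ : β < B)
    (hleft : β - α ≤ M * (α - A)) (hright : β - α ≤ M * (B - β)) :
    poincareLength (Icc α β) (Icc A B) ≤ ENNReal.ofReal (2 * M) := by
  have hlen : 0 ≤ β - α := sub_nonneg.2 hαβ
  have hA : 0 ≤ M := nonneg_of_mul_nonneg_left (hlen.trans hleft) (sub_pos.2 hα)
  have hAB : A ≤ B := by linarith
  rw [poincareLength, len_Icc hαβ, lo_Icc hαβ, hi_Icc hαβ, lo_Icc hAB, hi_Icc hAB, two_mul,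
    ENNReal.ofReal_add hA hA]
  exact add_le_add (logRatio_le (sub_pos.2 hα) hlen hleft) (logRatio_le (sub_pos.2 hβ) hlen hright)

theorem lt_of_poincareLength_Icc_ne_top {α β A B : ℝ} (hαβ : α ≤ β) (hAB : A ≤ B)
    (h : poincareLength (Icc α β) (Icc A B) ≠ ⊤) : A < α ∧ β < B := by
  rw [poincareLength, lo_Icc hαβ, hi_Icc hαβ, lo_Icc hAB, hi_Icc hAB, ENNReal.add_ne_top,
    logRatio_ne_top_iff, logRatio_ne_top_iff, sub_pos, sub_pos] at h
  exact h

theorem mul_le_of_poincareLength_Icc_le {α β A B Λ : ℝ} (hα : A < α) (hαβ : α ≤ β) (hβ : β < B)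
    (hΛ : 0 ≤ Λ) (hΛ₁ : Λ ≤ 1)
    (h : poincareLength (Icc α β) (Icc A B) ≤ ENNReal.ofReal Λ) :
    (β - α) * (B - A) ≤ 2 * Λ * ((α - A) * (B - β)) := by
  have hAB : A ≤ B := by linarith
  have hl : 0 < α - A := sub_pos.2 hα
  have hn : 0 < B - β := sub_pos.2 hβ
  have hm : 0 ≤ β - α := sub_nonneg.2 hαβ
  have h₁ : 1 ≤ 1 + (β - α) / (α - A) := by linarith [div_nonneg hm hl.le]
  have h₂ : 1 ≤ 1 + (β - α) / (B - β) := by linarith [div_nonneg hm hn.le]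
  rw [poincareLength, len_Icc hαβ, lo_Icc hαβ, hi_Icc hαβ, lo_Icc hAB, hi_Icc hAB, logRatio,
    logRatio, if_pos hl, if_pos hn, ← ENNReal.ofReal_add (Real.log_nonneg h₁) (Real.log_nonneg h₂),
    ENNReal.ofReal_le_ofReal_iff hΛ, ← Real.log_mul (by positivity) (by positivity),
    Real.log_le_iff_le_exp (by positivity)] at h
  have hexp : Real.exp Λ ≤ 1 + Λ + Λ ^ 2 := by
    linarith [(abs_le.1 (Real.abs_exp_sub_one_sub_id_le ((abs_of_nonneg hΛ).trans_le hΛ₁))).2]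
  have hcross : (1 + (β - α) / (α - A)) * (1 + (β - α) / (B - β)) =
      1 + (β - α) * (B - A) / ((α - A) * (B - β)) := by
    field_simp
    ring
  rw [← div_le_iff₀ (mul_pos hl hn)]
  nlinarith

theorem le_asymLength {U V : Set ℝ} {θ : ℝ} (hθ : 0 < θ) (hU : 0 < len U) (hV : 0 < len V)
    (h : len V ≤ θ * gapLen U V ∨ len U ≤ 2 * √θ * (gapLen U V + len U)) :
    ENNReal.ofReal (1 / 2 * Real.log (1 / θ) - Real.log 2) ≤ asymLength U V := by
  rcases h with h | h
  · have hVθ := le_logRatio (x := gapLen U V) hV hθ (h.trans (by linarith [mul_pos hθ hV]))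
    refine le_trans ?_ ((ENNReal.div_le_div_right hVθ 2).trans le_add_self)
    rw [← ENNReal.ofReal_ofNat, ← ENNReal.ofReal_div_of_pos two_pos]
    exact ENNReal.ofReal_le_ofReal (by linarith [Real.log_nonneg one_le_two])
  · refine le_trans (ENNReal.ofReal_le_ofReal ?_) ((le_logRatio hU (by positivity) h).trans
      le_self_add)
    rw [one_div θ, one_div (2 * √θ), Real.log_inv, Real.log_inv,
      Real.log_mul two_ne_zero (Real.sqrt_pos.2 hθ).ne', Real.log_sqrt hθ.le]
    linarith

namespace TData

namespace IsExpanding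

variable {g : TData} {r R a : ℝ}

/-! ### Parameters of the pre-renormalization -/

theorem mu_eq (hg : g.IsExpanding r R a) : g.mu = r / R := by
  have hr := hg.r_pos
  have hrR := hg.r_lt
  rw [mu, hg.J_eq, hg.central_eq, len_Icc (by linarith), len_Icc (by linarith),
    ← mul_div_mul_left r R two_ne_zero]
  ring_nf

variable {θ : ℝ} {x p' p q q' : ℝ} {k : ℕ}

theorem theta_pos (hg : g.IsExpanding r R a) (hθ : 4 * r * R ≤ θ * (R - r) ^ 2) : 0 < θ := by
  have hr := hg.r_pos
  have hR := hr.trans hg.r_lt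
  exact pos_of_mul_pos_left ((by positivity : 0 < 4 * r * R).trans_le hθ) (sq_nonneg _)

theorem returnBranch_space (hg : g.IsExpanding r R a) (hθ : 4 * r * R ≤ θ * (R - r) ^ 2)
    (hb : g.IsReturnBranch r a k x p' p q q') :
    (q - p) * (q' - p') ≤ θ * ((p - p') * (q' - q)) := by
  have hsides : 0 ≤ (p - p') * (q' - q) :=
    mul_nonneg (sub_nonneg.2 hb.left_lt.le) (sub_nonneg.2 hb.lt_right.le)
  have hcross := hb.expanding.preimage_crossRatio_le (hb.image_J.trans hg.J_eq)
    (hb.image_central.trans hg.central_eq) hb.left_lt hb.lt hb.lt_right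
  refine le_of_mul_le_mul_right ?_ (pow_pos (sub_pos.2 hg.r_lt) 2)
  linarith [mul_le_mul_of_nonneg_right hθ hsides]

theorem right_space (hg : g.IsExpanding r R a) (hθ : 4 * r * R ≤ θ * (R - r) ^ 2)
    (hb : g.IsReturnBranch r a k x p' p q q') : q - p ≤ θ * (q' - q) :=
  le_mul_of_mul_le_mul_mul (sub_pos.2 hb.left_lt) (sub_nonneg.2 hb.lt.le)
    (by linarith [hb.lt, hb.lt_right]) ((hg.returnBranch_space hθ hb).trans_eq (by ring))

theorem left_space (hg : g.IsExpanding r R a) (hθ : 4 * r * R ≤ θ * (R - r) ^ 2)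
    (hb : g.IsReturnBranch r a k x p' p q q') : q - p ≤ θ * (p - p') :=
  le_mul_of_mul_le_mul_mul (sub_pos.2 hb.lt_right) (sub_nonneg.2 hb.lt.le)
    (by linarith [hb.lt, hb.left_lt]) (hg.returnBranch_space hθ hb)

theorem sqrt_sub_sqrt_le (hg : g.IsExpanding r R a) (hθ : 4 * r * R ≤ θ * (R - r) ^ 2)
    (hb : g.IsReturnBranch r a k x p' p q q') (hp : 0 ≤ p) :
    √q - √p ≤ (2 * θ + √θ) * (r - √q) := by
  have hθ₀ := (hg.theta_pos hθ).le
  have hqr : q ≤ r ^ 2 := hb.lt_right.le.trans hb.le_sq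
  refine sub_le_mul_sub_of_sq_sub_sq_le hθ₀ (Real.sqrt_nonneg p)
    ((Real.sqrt_le_left hg.r_pos.le).2 hqr) ?_
  rw [Real.sq_sqrt hp, Real.sq_sqrt (hp.trans hb.lt.le)]
  exact (hg.right_space hθ hb).trans (mul_le_mul_of_nonneg_left (by linarith [hb.le_sq]) hθ₀)

theorem prerenorm_lam_le (hg : g.IsExpanding r R a) (hθ : 4 * r * R ≤ θ * (R - r) ^ 2) :
    g.prerenorm.lam ≤ ENNReal.ofReal (2 * (2 * θ + √θ)) := by
  refine iSup₂_le fun W hW => iSup_le fun hc => ?_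
  obtain ⟨u, hu⟩ := hW.2.left
  obtain ⟨k, p', p, q, q', hb, rfl⟩ := hg.exists_returnBranch_of_mem_pieces hW hu
  change g.c ∉ _ at hc
  change poincareLength _ g.central ≤ _
  have hq₀ := Real.sqrt_nonneg q
  have hp₀ := Real.sqrt_nonneg p
  have hqr : √q < r := (Real.sqrt_lt' hg.r_pos).2 (hb.lt_right.trans_le hb.le_sq)
  have hθ₀ := hg.theta_pos hθ
  rcases hg.component_eq hb with ⟨-, h⟩ | ⟨hp, h⟩
  · rw [h] at hc
    exact absurd ⟨by linarith, by linarith⟩ hc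
  have hpq := Real.sqrt_lt_sqrt hp.le hb.lt
  have hnear := hg.sqrt_sub_sqrt_le hθ hb hp.le
  have hfar : √q - √p ≤ (2 * θ + √θ) * (r + √p) :=
    hnear.trans (mul_le_mul_of_nonneg_left (by linarith) (by positivity))
  rcases h with h | h <;> rw [h, hg.central_eq] <;>
    refine poincareLength_Icc_le (by linarith) (by linarith) (by linarith) ?_ ?_
  · convert hfar using 1 <;> ring
  · convert hnear using 1 <;> ring
  · convert hnear using 1 <;> ring
  · convert hfar using 1 <;> ring

theorem exists_crit_returnBranch_prerenorm_mu_eq (hg : g.IsExpanding r R a) (hrec : g.Recurrent) :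
    ∃ k p' p q q', g.IsReturnBranch r a k g.c p' p q q' ∧ p ≤ 0 ∧ g.prerenorm.mu = √q / r := by
  obtain ⟨k, p', p, q, q', hb, hp, -, hcomp, -, hcen⟩ := hg.exists_crit_returnBranch hrec
  have hq := Real.sqrt_nonneg q
  have hr := hg.r_pos
  refine ⟨k, p', p, q, q', hb, hp, ?_⟩
  rw [mu, hcen, hcomp, len_Icc (by linarith)]
  change _ / len g.central = _
  rw [hg.central_eq, len_Icc (by linarith), ← mul_div_mul_left (√q) r two_ne_zero]
  ring_nf

theorem prerenorm_mu_le (hg : g.IsExpanding r R a) (hrec : g.Recurrent)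
    (hθ : 4 * r * R ≤ θ * (R - r) ^ 2) : g.prerenorm.mu ≤ √θ := by
  obtain ⟨k, p', p, q, q', hb, hp, hmu⟩ := hg.exists_crit_returnBranch_prerenorm_mu_eq hrec
  have hq : 0 ≤ q := (sq_nonneg _).trans hb.phi_mem.2
  rw [hmu]
  refine sqrt_div_le_sqrt hg.r_pos ?_
  linarith [hg.right_space hθ hb, mul_le_mul_of_nonneg_left
    (by linarith [hb.le_sq] : q' - q ≤ r ^ 2) (hg.theta_pos hθ).le]

theorem exists_inter_preimage_piece_eq_Icc (hg : g.IsExpanding r R a) {W : Set ℝ} {Λ : ℝ}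
    (hW : W ∈ g.pieces) (hne : W ≠ g.central) (hΛ : 0 ≤ Λ) (hΛ₁ : Λ ≤ 1)
    (hP : poincareLength W g.J ≤ ENNReal.ofReal Λ) :
    ∃ s t, Icc a (r ^ 2) ∩ g.diffeo g.central ⁻¹' W = Icc s t ∧ t - s ≤ 2 * Λ * (r ^ 2 - t) := by
  obtain ⟨α, β, rfl, hexp, -⟩ := hg.branch W hW hne
  have hαβ := hexp.lt
  have hRR : g.c - R ≤ g.c + R := by linarith [hg.r_pos, hg.r_lt]
  have himage := hg.image_central.trans hg.J_eq
  rw [hg.J_eq] at hP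
  obtain ⟨hα, hβ⟩ := lt_of_poincareLength_Icc_ne_top hαβ.le hRR
    (hP.trans_lt ENNReal.ofReal_lt_top).ne
  have hsmall := mul_le_of_poincareLength_Icc_le hα hαβ.le hβ hΛ hΛ₁ hP
  obtain ⟨s, t, has, hst, htr, hpre⟩ :=
    hg.expanding_central.exists_inter_preimage_Icc_eq_of_lt himage hα hαβ hβ
  have himst : g.diffeo g.central '' Icc s t = Icc α β := by
    rw [← hpre, image_inter_preimage, himage]
    exact inter_eq_right.2 (Icc_subset_Icc hα.le hβ.le)
  refine ⟨s, t, hpre, ?_⟩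
  have hcross := hg.expanding_central.preimage_crossRatio_le himage himst has hst htr
  have hsides : 0 ≤ (s - a) * (r ^ 2 - t) :=
    mul_nonneg (sub_nonneg.2 has.le) (sub_nonneg.2 htr.le)
  refine le_mul_of_mul_le_mul_mul (sub_pos.2 has) (sub_nonneg.2 hst.le)
    (by linarith : s - a ≤ r ^ 2 - a) ?_
  refine le_of_mul_le_mul_right ?_ (mul_pos (sub_pos.2 hα) (sub_pos.2 hβ))
  linarith [mul_le_mul_of_nonneg_right hsmall hsides]

theorem returnBranch_width_le (hg : g.IsExpanding r R a) {W : Set ℝ} {Λ : ℝ}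
    (hb : g.IsReturnBranch r a k x p' p q q') (hW : W ∈ g.pieces) (hne : W ≠ g.central)
    (hx : g.map x ∈ W) (hΛ : 0 ≤ Λ) (hΛ₁ : Λ ≤ 1)
    (hP : poincareLength W g.J ≤ ENNReal.ofReal Λ) : q' - p' ≤ 2 * Λ * r ^ 2 := by
  obtain ⟨s, t, hpre, hst⟩ := hg.exists_inter_preimage_piece_eq_Icc hW hne hΛ hΛ₁ hP
  have hk : 0 < k := Nat.pos_of_ne_zero fun hk => hne <|
    hg.eq_of_mem hW hg.central_mem hx (by subst hk; exact hb.firstReturn.2.2.2.2)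
  have hsub : Icc p' q' ⊆ Icc s t := by
    rw [← hb.cylinder_eq, ← hpre]
    refine inter_subset_inter_right _ (preimage_mono fun u hu => ?_)
    obtain ⟨V, hV, hxV, huV⟩ := hu.2 0 hk
    rwa [hg.eq_of_mem hW hV hx hxV]
  obtain ⟨hs, ht⟩ := (Icc_subset_Icc_iff hb.expanding.lt.le).1 hsub
  have ht₀ : 0 ≤ t := ((sq_nonneg _).trans hb.phi_mem.2).trans (hb.lt_right.le.trans ht)
  linarith [mul_nonneg hΛ ht₀]

theorem prerenorm_mu_le_of_nonCentralReturn (hg : g.IsExpanding r R a) (hrec : g.Recurrent)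
    (hθ : 4 * r * R ≤ θ * (R - r) ^ 2) (hnc : g.NonCentralReturn) (hlam : g.lam ≤ 1) :
    g.prerenorm.mu ≤ √(2 * θ * g.lam.toReal) := by
  obtain ⟨k, p', p, q, q', hb, hp, hmu⟩ := hg.exists_crit_returnBranch_prerenorm_mu_eq hrec
  have htop : g.lam ≠ ⊤ := (hlam.trans_lt ENNReal.one_lt_top).ne
  obtain ⟨W, hW, hcW⟩ := hrec.1 1
  have hne : W ≠ g.central := fun h => hnc (h ▸ hcW)
  have hP : poincareLength W g.J ≤ ENNReal.ofReal g.lam.toReal := by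
    rw [ENNReal.ofReal_toReal htop, lam]
    exact le_iSup₂_of_le W hW (le_iSup_of_le
      (fun h => hne (hg.eq_of_mem hW hg.central_mem h hg.c_mem)) le_rfl)
  have hwidth := hg.returnBranch_width_le hb hW hne hcW ENNReal.toReal_nonneg
    (ENNReal.toReal_le_of_le_ofReal zero_le_one (by rwa [ENNReal.ofReal_one])) hP
  have hgap : q' - q ≤ 2 * g.lam.toReal * r ^ 2 := by linarith [hb.left_lt, hb.lt]
  rw [hmu]
  refine sqrt_div_le_sqrt hg.r_pos ?_
  linarith [hg.right_space hθ hb, mul_le_mul_of_nonneg_left hgap (hg.theta_pos hθ).le]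

theorem boundary_dist_bounds (hg : g.IsExpanding r R a) (hb : g.IsReturnBranch r a k x p' p q q')
    {e z : ℝ} (he : e = p' ∨ e = q') (hz : z ∈ Icc p q) :
    (R - r) ^ 2 ≤ (g.returnDiffeo k e - g.returnDiffeo k z) ^ 2 ∧
      (g.returnDiffeo k e - g.returnDiffeo k z) ^ 2 ≤ (R + r) ^ 2 := by
  have hrR := hg.r_lt
  have hr := hg.r_pos
  have hFz : g.returnDiffeo k z ∈ Icc (g.c - r) (g.c + r) := by
    rw [← hg.central_eq, ← hb.image_central]
    exact mem_image_of_mem _ hz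
  have hFe : g.returnDiffeo k e = g.c - R ∨ g.returnDiffeo k e = g.c + R := by
    have := hb.expanding.image_endpoints (hb.image_J.trans hg.J_eq)
    grind
  obtain ⟨hFz₁, hFz₂⟩ := hFz
  rw [sq_le_sq, sq_le_sq, abs_of_pos (sub_pos.2 hrR), abs_of_pos (add_pos (hr.trans hrR) hr)]
  rcases hFe with h | h <;> rw [h]
  · rw [abs_of_neg (by linarith)]
    constructor <;> linarith
  · rw [abs_of_pos (by linarith)]
    constructor <;> linarith

theorem derivWithin_returnDiffeo_le (hg : g.IsExpanding r R a)
    (hb : g.IsReturnBranch r a k x p' p q q') {y z : ℝ} (hy : y ∈ Icc p q) (hz : z ∈ Icc p q) :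
    |derivWithin (g.returnDiffeo k) (Icc p' q') y| * (R - r) ^ 2 ≤
      |derivWithin (g.returnDiffeo k) (Icc p' q') z| * (R + r) ^ 2 := by
  have hkoebe : ∃ e, (e = p' ∨ e = q') ∧ |derivWithin (g.returnDiffeo k) (Icc p' q') y| *
      (g.returnDiffeo k e - g.returnDiffeo k z) ^ 2 ≤
        |derivWithin (g.returnDiffeo k) (Icc p' q') z| *
          (g.returnDiffeo k e - g.returnDiffeo k y) ^ 2 := by
    have hp := hb.left_lt
    have hq := hb.lt_right
    rcases lt_trichotomy y z with h | rfl | h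
    · exact ⟨q', .inr rfl, hb.expanding.koebe_right (hp.le.trans hy.1) h (hz.2.trans_lt hq)⟩
    · exact ⟨q', .inr rfl, le_rfl⟩
    · exact ⟨p', .inl rfl, hb.expanding.koebe_left (hp.trans_le hz.1) h (hy.2.trans hq.le)⟩
  obtain ⟨e, he, hle⟩ := hkoebe
  exact (mul_le_mul_of_nonneg_left (hg.boundary_dist_bounds hb he hz).1 (abs_nonneg _)).trans
    (hle.trans (mul_le_mul_of_nonneg_left (hg.boundary_dist_bounds hb he hy).2 (abs_nonneg _)))

theorem prerenorm_rho_le (hg : g.IsExpanding r R a) :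
    g.prerenorm.rho ≤ ENNReal.ofReal (4 * r / (R - r)) := by
  refine iSup₂_le fun W hW => ?_
  obtain ⟨u, hu⟩ := hW.2.left
  obtain ⟨k, p', p, q, q', hb, rfl⟩ := hg.exists_returnBranch_of_mem_pieces hW hu
  rw [hg.prerenorm_dom hb, hg.prerenorm_diffeo hb.firstReturn]
  refine iSup₂_le fun y hy => iSup₂_le fun z hz => ENNReal.ofReal_le_ofReal ?_
  have hsub : Icc p q ⊆ Icc p' q' := Icc_subset_Icc hb.left_lt.le hb.lt_right.le
  have hderiv : ∀ w ∈ Icc p q, derivWithin (g.returnDiffeo k) (Icc p q) w =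
      derivWithin (g.returnDiffeo k) (Icc p' q') w := fun w hw =>
    ((hb.expanding.hasDerivWithinAt (hsub hw)).mono hsub).derivWithin (uniqueDiffOn_Icc hb.lt w hw)
  have hpos : ∀ w ∈ Icc p q, 0 < |derivWithin (g.returnDiffeo k) (Icc p' q') w| := fun w hw =>
    abs_pos.2 (hb.expanding.derivWithin_ne_zero w (hsub hw))
  have hr := hg.r_pos
  have hRr : 0 < R - r := sub_pos.2 hg.r_lt
  have hR : 0 < R + r := by linarith
  rw [hderiv y hy, hderiv z hz]
  have hratio : |derivWithin (g.returnDiffeo k) (Icc p' q') y| /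
      |derivWithin (g.returnDiffeo k) (Icc p' q') z| ≤ ((R + r) / (R - r)) ^ 2 := by
    rw [div_pow, div_le_div_iff₀ (hpos z hz) (by positivity), mul_comm (_ ^ 2)]
    exact hg.derivWithin_returnDiffeo_le hb hy hz
  calc Real.log _ ≤ Real.log (((R + r) / (R - r)) ^ 2) :=
        Real.log_le_log (div_pos (hpos y hy) (hpos z hz)) hratio
    _ = 2 * Real.log ((R + r) / (R - r)) := by rw [Real.log_pow, Nat.cast_ofNat]
    _ ≤ 2 * ((R + r) / (R - r) - 1) :=
        mul_le_mul_of_nonneg_left (Real.log_le_sub_one_of_pos (by positivity)) zero_le_two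
    _ = 4 * r / (R - r) := by field_simp; ring

end IsExpanding

end TData

/-! ### The gap between two intervals of the pre-renormalization -/

namespace TData

namespace IsExpanding

variable {g : TData} {r R a θ : ℝ} {x₁ x₂ p₁' p₁ q₁ q₁' p₂' p₂ q₂ q₂' : ℝ} {k₁ k₂ : ℕ}

theorem Icc_eq_of_mem_of_mem (hg : g.IsExpanding r R a)
    (hb₁ : g.IsReturnBranch r a k₁ x₁ p₁' p₁ q₁ q₁')
    (hb₂ : g.IsReturnBranch r a k₂ x₂ p₂' p₂ q₂ q₂') (hk : k₂ ≤ k₁) {u : ℝ}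
    (hu₁ : u ∈ Icc p₁' q₁') (hu₂ : u ∈ Icc p₂ q₂) : Icc p₁ q₁ = Icc p₂ q₂ := by
  rw [← hb₁.cylinder_eq] at hu₁
  rw [← hb₂.pullback_eq] at hu₂
  obtain ⟨-, h⟩ := hg.eq_of_mem_cylinder_of_mem_pullback hb₁.firstReturn hk hu₁.2 hu₂.2
  rw [← hb₁.pullback_eq, ← hb₂.pullback_eq, h]

/-- The space `[p', q']` of the branch with the larger return time does not meet the other one. -/
theorem returnBranch_gap (hg : g.IsExpanding r R a) (hθ : 4 * r * R ≤ θ * (R - r) ^ 2)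
    (hb₁ : g.IsReturnBranch r a k₁ x₁ p₁' p₁ q₁ q₁')
    (hb₂ : g.IsReturnBranch r a k₂ x₂ p₂' p₂ q₂ q₂') (hle : q₁ ≤ p₂) :
    q₂ - p₂ ≤ θ * (p₂ - q₁) ∨ q₁ - p₁ ≤ θ * (p₂ - q₁) := by
  have hθ₀ := (hg.theta_pos hθ).le
  have hlt₁ := hb₁.lt
  have hlt₂ := hb₂.lt
  have hne : Icc p₁ q₁ ≠ Icc p₂ q₂ := fun h => by
    have := (h.le (left_mem_Icc.2 hlt₁.le)).1
    linarith
  rcases le_total k₁ k₂ with hk | hk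
  · left
    have hfree : q₁ < p₂' := by
      by_contra! h
      exact hne (hg.Icc_eq_of_mem_of_mem hb₂ hb₁ hk
        ⟨h, hle.trans (hlt₂.trans hb₂.lt_right).le⟩ (right_mem_Icc.2 hlt₁.le)).symm
    exact (hg.left_space hθ hb₂).trans (mul_le_mul_of_nonneg_left (by linarith) hθ₀)
  · right
    have hfree : q₁' < p₂ := by
      by_contra! h
      exact hne (hg.Icc_eq_of_mem_of_mem hb₁ hb₂ hk
        ⟨(hb₁.left_lt.trans hlt₁).le.trans hle, h⟩ (left_mem_Icc.2 hlt₂.le))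
    exact (hg.right_space hθ hb₁).trans (mul_le_mul_of_nonneg_left (by linarith) hθ₀)

theorem component_endpoints (hg : g.IsExpanding r R a) (hrec : g.Recurrent) {W : Set ℝ}
    (hb : g.IsReturnBranch r a k₁ x₁ p₁' p₁ q₁ q₁') (hW : W = g.component (k₁ + 1) x₁) :
    (p₁ ≤ 0 ∧ lo W = g.c - √q₁ ∧ hi W = g.c + √q₁) ∨
    (0 < p₁ ∧ lo W = g.c + √p₁ ∧ hi W = g.c + √q₁) ∨
    (0 < p₁ ∧ lo W = g.c - √q₁ ∧ hi W = g.c - √p₁) := by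
  have hq := Real.sqrt_pos.2 (hg.right_pos hrec hb)
  have hpq := (Real.sqrt_lt_sqrt_iff_of_pos (hg.right_pos hrec hb)).2 hb.lt
  rcases hg.component_eq hb with ⟨hp, h⟩ | ⟨hp, h | h⟩ <;>
    rw [hW, h, lo_Icc (by linarith), hi_Icc (by linarith)]
  · exact .inl ⟨hp, rfl, rfl⟩
  · exact .inr (.inl ⟨hp, rfl, rfl⟩)
  · exact .inr (.inr ⟨hp, rfl, rfl⟩)

theorem len_component (hg : g.IsExpanding r R a) (hrec : g.Recurrent) {W : Set ℝ}
    (hb : g.IsReturnBranch r a k₁ x₁ p₁' p₁ q₁ q₁') (hW : W = g.component (k₁ + 1) x₁) :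
    (p₁ ≤ 0 ∧ len W = 2 * √q₁) ∨ (0 < p₁ ∧ len W = √q₁ - √p₁) := by
  rw [len]
  rcases hg.component_endpoints hrec hb hW with ⟨hp, hlo, hhi⟩ | ⟨hp, hlo, hhi⟩ | ⟨hp, hlo, hhi⟩
  · exact .inl ⟨hp, by rw [hlo, hhi]; ring⟩
  · exact .inr ⟨hp, by rw [hlo, hhi]; ring⟩
  · exact .inr ⟨hp, by rw [hlo, hhi]; ring⟩

theorem len_component_pos (hg : g.IsExpanding r R a) (hrec : g.Recurrent) {W : Set ℝ}
    (hb : g.IsReturnBranch r a k₁ x₁ p₁' p₁ q₁ q₁') (hW : W = g.component (k₁ + 1) x₁) :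
    0 < len W := by
  have hq := hg.right_pos hrec hb
  rcases hg.len_component hrec hb hW with ⟨-, h⟩ | ⟨-, h⟩ <;> rw [h]
  · exact mul_pos two_pos (Real.sqrt_pos.2 hq)
  · exact sub_pos.2 ((Real.sqrt_lt_sqrt_iff_of_pos hq).2 hb.lt)

theorem gapLen_eq (hg : g.IsExpanding r R a) (hrec : g.Recurrent) {U V : Set ℝ}
    (hb₁ : g.IsReturnBranch r a k₁ x₁ p₁' p₁ q₁ q₁') (hU : U = g.component (k₁ + 1) x₁)
    (hb₂ : g.IsReturnBranch r a k₂ x₂ p₂' p₂ q₂ q₂') (hV : V = g.component (k₂ + 1) x₂)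
    (hcl : IsCloser g.c U V) : 0 < p₂ ∧ √q₁ ≤ √p₂ ∧ gapLen U V = √p₂ - √q₁ := by
  have hq₁ := Real.sqrt_pos.2 (hg.right_pos hrec hb₁)
  have hpq₁ := (Real.sqrt_lt_sqrt_iff_of_pos (hg.right_pos hrec hb₁)).2 hb₁.lt
  have hq₂ := Real.sqrt_pos.2 (hg.right_pos hrec hb₂)
  have hpq₂ := (Real.sqrt_lt_sqrt_iff_of_pos (hg.right_pos hrec hb₂)).2 hb₂.lt
  have hp₁ := Real.sqrt_pos (x := p₁)
  have hp₂ := Real.sqrt_pos (x := p₂)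
  have hendsU := hg.component_endpoints hrec hb₁ hU
  have hendsV := hg.component_endpoints hrec hb₂ hV
  rw [IsCloser] at hcl
  rw [gapLen]
  grind

theorem len_le_mul_gapLen (hg : g.IsExpanding r R a) (hrec : g.Recurrent) {U V : Set ℝ}
    (hb₁ : g.IsReturnBranch r a k₁ x₁ p₁' p₁ q₁ q₁') (hU : U = g.component (k₁ + 1) x₁)
    (hb₂ : g.IsReturnBranch r a k₂ x₂ p₂' p₂ q₂ q₂') (hV : V = g.component (k₂ + 1) x₂)
    (hcl : IsCloser g.c U V) (hθ₀ : 0 ≤ θ) (hgap : q₂ - p₂ ≤ θ * (p₂ - q₁)) :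
    len V ≤ θ * gapLen U V := by
  obtain ⟨hp₂, hqp, hgapLen⟩ := hg.gapLen_eq hrec hb₁ hU hb₂ hV hcl
  have hlen : len V = √q₂ - √p₂ :=
    ((hg.len_component hrec hb₂ hV).resolve_left fun h => h.1.not_gt hp₂).2
  have hq₁ := hg.right_pos hrec hb₁
  have hq₂ := hg.right_pos hrec hb₂
  have hpq₂ := Real.sqrt_le_sqrt hb₂.lt.le
  rw [hlen, hgapLen]
  refine le_of_mul_le_mul_right ?_ (add_pos (Real.sqrt_pos.2 hq₂) (Real.sqrt_pos.2 hp₂))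
  calc (√q₂ - √p₂) * (√q₂ + √p₂) = q₂ - p₂ := by
        rw [mul_comm, ← sq_sub_sq, Real.sq_sqrt hq₂.le, Real.sq_sqrt hp₂.le]
    _ ≤ θ * (p₂ - q₁) := hgap
    _ = θ * (√p₂ - √q₁) * (√q₁ + √p₂) := by
        rw [mul_assoc, add_comm, mul_comm (√p₂ - √q₁), ← sq_sub_sq, Real.sq_sqrt hp₂.le,
          Real.sq_sqrt hq₁.le]
    _ ≤ θ * (√p₂ - √q₁) * (√q₂ + √p₂) :=
        mul_le_mul_of_nonneg_left (by linarith) (mul_nonneg hθ₀ (sub_nonneg.2 hqp))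

theorem len_le_mul_gapLen_add_len (hg : g.IsExpanding r R a) (hrec : g.Recurrent) {U V : Set ℝ}
    (hb₁ : g.IsReturnBranch r a k₁ x₁ p₁' p₁ q₁ q₁') (hU : U = g.component (k₁ + 1) x₁)
    (hb₂ : g.IsReturnBranch r a k₂ x₂ p₂' p₂ q₂ q₂') (hV : V = g.component (k₂ + 1) x₂)
    (hcl : IsCloser g.c U V) (hθ₀ : 0 ≤ θ) (hgap : q₁ - p₁ ≤ θ * (p₂ - q₁)) :
    len U ≤ 2 * √θ * (gapLen U V + len U) := by
  obtain ⟨hp₂, hqp, hgapLen⟩ := hg.gapLen_eq hrec hb₁ hU hb₂ hV hcl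
  have hq₁ := hg.right_pos hrec hb₁
  have hp₁ : p₁ ≤ √p₁ ^ 2 := by
    rw [Real.sq_sqrt']
    exact le_max_left _ _
  have hlt : √p₁ < √q₁ := (Real.sqrt_lt_sqrt_iff_of_pos hq₁).2 hb₁.lt
  have hroot : √q₁ - √p₁ ≤ √θ * (√p₂ - √p₁) := by
    refine sub_le_sqrt_mul_sub_of_sq_sub_sq_le hθ₀ (Real.sqrt_nonneg p₁) hlt hqp ?_
    rw [Real.sq_sqrt hq₁.le, Real.sq_sqrt hp₂.le]
    linarith
  rcases hg.len_component hrec hb₁ hU with ⟨hp, hlen⟩ | ⟨-, hlen⟩ <;> rw [hlen, hgapLen]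
  · rw [Real.sqrt_eq_zero_of_nonpos hp] at hroot
    linarith [mul_nonneg (Real.sqrt_nonneg θ) (Real.sqrt_nonneg q₁)]
  · linarith

theorem le_prerenorm_gapK (hg : g.IsExpanding r R a) (hrec : g.Recurrent)
    (hθ : 4 * r * R ≤ θ * (R - r) ^ 2) :
    ENNReal.ofReal (1 / 2 * Real.log (1 / θ) - Real.log 2) ≤ g.prerenorm.gapK := by
  refine le_iInf₂ fun U hU => le_iInf₂ fun V hV => le_iInf fun (hcl : IsCloser g.c U V) => ?_
  obtain ⟨u, hu⟩ := hU.2.left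
  obtain ⟨k₁, p₁', p₁, q₁, q₁', hb₁, hU⟩ := hg.exists_returnBranch_of_mem_pieces hU hu
  obtain ⟨v, hv⟩ := hV.2.left
  obtain ⟨k₂, p₂', p₂, q₂, q₂', hb₂, hV⟩ := hg.exists_returnBranch_of_mem_pieces hV hv
  obtain ⟨hp₂, hqp, -⟩ := hg.gapLen_eq hrec hb₁ hU hb₂ hV hcl
  have hθ₀ := hg.theta_pos hθ
  refine le_asymLength hθ₀ (hg.len_component_pos hrec hb₁ hU) (hg.len_component_pos hrec hb₂ hV) ?_
  rcases hg.returnBranch_gap hθ hb₁ hb₂ ((Real.sqrt_le_sqrt_iff hp₂.le).1 hqp) with h | h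
  · exact .inl (hg.len_le_mul_gapLen hrec hb₁ hU hb₂ hV hcl hθ₀.le h)
  · exact .inr (hg.len_le_mul_gapLen_add_len hrec hb₁ hU hb₂ hV hcl hθ₀.le h)

end IsExpanding

end TData

/-! ### Bounds in terms of the scaling factor -/

namespace TData

namespace IsExpanding

variable {g : TData} {r R a K : ℝ}

theorem mu_pos (hg : g.IsExpanding r R a) : 0 < g.mu := by
  rw [hg.mu_eq]
  exact div_pos hg.r_pos (hg.r_pos.trans hg.r_lt)

theorem mu_lt_one (hg : g.IsExpanding r R a) : g.mu < 1 := by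
  rw [hg.mu_eq]
  exact (div_lt_one (hg.r_pos.trans hg.r_lt)).2 hg.r_lt

theorem mu_le_sqrt_mu (hg : g.IsExpanding r R a) : g.mu ≤ √g.mu :=
  Real.le_sqrt_of_sq_le (pow_le_of_le_one hg.mu_pos.le hg.mu_lt_one.le two_ne_zero)

theorem four_le_of_four_le_mul_sq (hg : g.IsExpanding r R a) (hK : 4 ≤ K * (1 - g.mu) ^ 2) :
    4 ≤ K := by
  have hμ := hg.mu_pos
  have hsq : (1 - g.mu) ^ 2 ≤ 1 := pow_le_one₀ (by linarith [hg.mu_lt_one]) (by linarith)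
  have hK₀ : 0 ≤ K := by
    by_contra! h
    linarith [mul_nonpos_of_nonpos_of_nonneg h.le (sq_nonneg (1 - g.mu))]
  exact hK.trans (mul_le_of_le_one_right hK₀ hsq)

theorem four_mul_mul_le (hg : g.IsExpanding r R a) (hK : 4 ≤ K * (1 - g.mu) ^ 2) :
    4 * r * R ≤ K * g.mu * (R - r) ^ 2 := by
  have hR : 0 < R := hg.r_pos.trans hg.r_lt
  have hr : g.mu * R = r := by rw [hg.mu_eq, div_mul_cancel₀ _ hR.ne']
  calc 4 * r * R = 4 * (g.mu * R ^ 2) := by rw [← hr]; ring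
    _ ≤ K * (1 - g.mu) ^ 2 * (g.mu * R ^ 2) :=
      mul_le_mul_of_nonneg_right hK (mul_nonneg hg.mu_pos.le (sq_nonneg R))
    _ = K * g.mu * (R - r) ^ 2 := by rw [← hr]; ring

theorem sqrt_mul_mu_le (hK : 1 ≤ K) : √(K * g.mu) ≤ K * √g.mu := by
  rw [Real.sqrt_mul (by linarith)]
  exact mul_le_mul_of_nonneg_right (Real.sqrt_le_self_iff.2 (.inr hK)) (Real.sqrt_nonneg _)

theorem prerenorm_lam_le_mul_sqrt (hg : g.IsExpanding r R a) (hK : 4 ≤ K * (1 - g.mu) ^ 2) :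
    g.prerenorm.lam ≤ ENNReal.ofReal (6 * K * √g.mu) := by
  refine (hg.prerenorm_lam_le (hg.four_mul_mul_le hK)).trans (ENNReal.ofReal_le_ofReal ?_)
  have hK₄ := hg.four_le_of_four_le_mul_sq hK
  have hroot := sqrt_mul_mu_le (g := g) (by linarith : 1 ≤ K)
  have hmu := mul_le_mul_of_nonneg_left hg.mu_le_sqrt_mu (by linarith : 0 ≤ K)
  linarith

theorem prerenorm_mu_le_mul_sqrt (hg : g.IsExpanding r R a) (hrec : g.Recurrent)
    (hK : 4 ≤ K * (1 - g.mu) ^ 2) : g.prerenorm.mu ≤ 2 * K * √g.mu := by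
  have hK₄ := hg.four_le_of_four_le_mul_sq hK
  have hroot := sqrt_mul_mu_le (g := g) (by linarith : 1 ≤ K)
  have hnonneg : 0 ≤ K * √g.mu := mul_nonneg (by linarith) (Real.sqrt_nonneg _)
  linarith [hg.prerenorm_mu_le hrec (hg.four_mul_mul_le hK)]

theorem prerenorm_rho_le_mul (hg : g.IsExpanding r R a) (hK : 4 ≤ K * (1 - g.mu) ^ 2) :
    g.prerenorm.rho ≤ ENNReal.ofReal (K * g.mu) := by
  refine hg.prerenorm_rho_le.trans (ENNReal.ofReal_le_ofReal ?_)
  have hr := hg.r_pos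
  have hrR : 0 < R - r := sub_pos.2 hg.r_lt
  have hKμ : 0 ≤ K * g.mu :=
    mul_nonneg (by linarith [hg.four_le_of_four_le_mul_sq hK]) hg.mu_pos.le
  rw [div_le_iff₀ hrR]
  refine le_of_mul_le_mul_right ?_ (hr.trans hg.r_lt)
  calc 4 * r * R ≤ K * g.mu * (R - r) * (R - r) := by linarith [hg.four_mul_mul_le hK]
    _ ≤ K * g.mu * (R - r) * R :=
      mul_le_mul_of_nonneg_left (by linarith) (mul_nonneg hKμ hrR.le)

theorem half_log_sub_le_prerenorm_gapK (hg : g.IsExpanding r R a) (hrec : g.Recurrent)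
    (hK : 4 ≤ K * (1 - g.mu) ^ 2) :
    ENNReal.ofReal (1 / 2 * Real.log (1 / g.mu) - K) ≤ g.prerenorm.gapK := by
  refine le_trans (ENNReal.ofReal_le_ofReal ?_)
    (hg.le_prerenorm_gapK hrec (hg.four_mul_mul_le hK))
  have hK₄ := hg.four_le_of_four_le_mul_sq hK
  rw [one_div g.mu, one_div (K * g.mu), Real.log_inv, Real.log_inv,
    Real.log_mul (by linarith) hg.mu_pos.ne']
  have hlogK := Real.log_le_sub_one_of_pos (by linarith : 0 < K)
  have hlog2 := Real.log_le_sub_one_of_pos (two_pos : (0 : ℝ) < 2)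
  linarith

theorem prerenorm_mu_le_mul_sqrt_lamStar (hg : g.IsExpanding r R a) (hrec : g.Recurrent)
    (hK : 4 ≤ K * (1 - g.mu) ^ 2) (hnc : g.NonCentralReturn) :
    g.prerenorm.mu ≤ 2 * K * √(g.mu * g.lamStar) := by
  have hK₄ := hg.four_le_of_four_le_mul_sq hK
  rcases le_total g.lam 1 with hlam | hlam
  · calc g.prerenorm.mu ≤ √(2 * (K * g.mu) * g.lam.toReal) :=
        hg.prerenorm_mu_le_of_nonCentralReturn hrec (hg.four_mul_mul_le hK) hnc hlam
      _ = √(2 * K) * √(g.mu * g.lamStar) := by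
        rw [TData.lamStar, min_eq_left hlam, ← Real.sqrt_mul (by linarith)]
        ring_nf
      _ ≤ 2 * K * √(g.mu * g.lamStar) :=
        mul_le_mul_of_nonneg_right (Real.sqrt_le_self_iff.2 (.inr (by linarith)))
          (Real.sqrt_nonneg _)
  · rw [TData.lamStar, min_eq_right hlam, ENNReal.toReal_one, mul_one]
    exact hg.prerenorm_mu_le_mul_sqrt hrec hK

end IsExpanding

end TData

end Renorm

theorem lemma3p12_general (μbar : ℝ) (hμ1 : μbar < 1) :
    ∃ C : ℝ, 0 < C ∧ ∀ (g : Renorm.TData) (r R a : ℝ), g.IsExpanding r R a → g.Recurrent →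
      ∀ n : ℕ, (g.level n).mu < μbar →
        (g.level (n + 1)).lam ≤ ENNReal.ofReal (C * √(g.level n).mu) ∧
        (g.level (n + 1)).mu ≤ C * √(g.level n).mu ∧
        (g.level (n + 1)).rho ≤ ENNReal.ofReal (C * (g.level n).mu) ∧
        ENNReal.ofReal (1 / 2 * Real.log (1 / (g.level n).mu) - C)
          ≤ (g.level (n + 1)).gapK ∧
        ((g.level n).NonCentralReturn →
          (g.level (n + 1)).mu ≤ C * √((g.level n).mu * (g.level n).lamStar)) := by
  have hsub : 0 < 1 - μbar := sub_pos.2 hμ1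
  obtain ⟨K, hK₀, hK⟩ : ∃ K : ℝ, 0 < K ∧ K * (1 - μbar) ^ 2 = 4 :=
    ⟨4 / (1 - μbar) ^ 2, div_pos four_pos (pow_pos hsub 2),
      div_mul_cancel₀ _ (pow_pos hsub 2).ne'⟩
  refine ⟨6 * K, by positivity, fun g r R a hg hrec n hμ => ?_⟩
  obtain ⟨⟨r, R, a, hn⟩, hrec⟩ := hg.level hrec n
  have hKμ : 4 ≤ K * (1 - (g.level n).mu) ^ 2 := by rw [← hK]; gcongr
  have hμ₀ := hn.mu_pos
  refine ⟨hn.prerenorm_lam_le_mul_sqrt hKμ, (hn.prerenorm_mu_le_mul_sqrt hrec hKμ).trans ?_,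
    (hn.prerenorm_rho_le_mul hKμ).trans (ENNReal.ofReal_le_ofReal ?_),
    (ENNReal.ofReal_le_ofReal ?_).trans (hn.half_log_sub_le_prerenorm_gapK hrec hKμ),
    fun hnc => (hn.prerenorm_mu_le_mul_sqrt_lamStar hrec hKμ hnc).trans ?_⟩
  · gcongr; norm_num
  · gcongr; linarith
  · gcongr; linarith
  · gcongr; norm_num

theorem lemma3p12 (μbar : ℝ) (hμ0 : 0 < μbar) (hμ1 : μbar < 1) :
    ∃ C : ℝ, 0 < C ∧ ∀ ρbar Kbar : ℝ, 0 < ρbar → ρbar < μbar → 0 < Kbar →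
      ∀ g : Renorm.TData, g.ClassT → g.Recurrent → ∀ n : ℕ,
        (g.level n).rho < ENNReal.ofReal ρbar →
        (g.level n).mu < μbar →
        ENNReal.ofReal Kbar < (g.level n).gapK →
          (g.level (n + 1)).lam ≤ ENNReal.ofReal (C * √(g.level n).mu) ∧
          (g.level (n + 1)).mu ≤ C * √(g.level n).mu ∧
          (g.level (n + 1)).rho ≤ ENNReal.ofReal (C * (g.level n).mu) ∧
          ENNReal.ofReal (1 / 2 * Real.log (1 / (g.level n).mu) - C)
            ≤ (g.level (n + 1)).gapK ∧
          ((g.level n).NonCentralReturn →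
            (g.level (n + 1)).mu ≤ C * √((g.level n).mu * (g.level n).lamStar)) := by
  obtain ⟨C, hC, h⟩ := lemma3p12_general μbar hμ1
  exact ⟨C, hC, fun _ _ _ _ _ g hg hrec n _ hμ _ =>
    let ⟨r, R, a, hE⟩ := hg.isExpanding; h g r R a hE hrec n hμ⟩
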